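/- Let $V,H$ be finite-dimensional nonzero complex Hilbert spaces with fixed orthonormal bases (the visible and the hidden system), of dimensions $d_v,d_h\ge 1$. Let $J\in\mathbb{N}$, let $G_1,\dots,G_J$ be Hermitian operators on $V\otimes H$, and for $\theta\in\mathbb{R}^J$ put $$G(\theta)=\sum_{j=1}^J\theta_jG_j,\qquad \sigma_{vh}(\theta)=\frac{e^{-G(\theta)}}{\operatorname{Tr}[e^{-G(\theta)}]},\qquad \sigma_v(\theta)=\operatorname{Tr}_h[\sigma_{vh}(\theta)].$$ Let $\rho$ be a state on $V$ (positive semidefinite, trace one), and let $q\in(0,1)\cup(1,2]$. Write $\langle A\rangle_\omega=\operatorname{Tr}[A\omega]$, $\{A,B\}=AB+BA$, and $$Q_q(\rho\|\sigma)=\operatorname{Tr}[\rho^q\sigma^{1-q}],\qquad D_q(\rho\|\sigma)=\frac{Q_q(\rho\|\sigma)-1}{q-1}.$$ Let $$\gamma(t)=\frac2\pi\ln\left|\coth\left(\frac{\pi t}{2}\right)\right|,\qquad \beta_r(t)=\frac{\sin(\pi r)}{2r(\cosh(\pi t)+\cos(\pi r))},$$ and define the maps $$\Upsilon_v^{\theta,q}(X)=\int_{-\infty}^\infty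 \beta_{1-q}(t)\,\sigma_v(\theta)^{-it/2}X\sigma_v(\theta)^{it/2}\,dt,\qquad \Xi_{v\to vh}^{\theta,q}(R)=\tfrac12\left\{\sigma_{vh}(\theta),\ \sigma_v(\theta)^{-q/2}R\,\sigma_v(\theta)^{-q/2}\otimes I_h\right\},$$ $$\Phi_{vh}^{\theta}(Y)=\int_{-\infty}^\infty\gamma(t)\,e^{-iG(\theta)t}Ye^{iG(\theta)t}\,dt,\qquad \Sigma_{v\to vh}^{\theta,q}=\Phi_{vh}^\theta\circ\Xi_{v\to vh}^{\theta,q}\circ\Upsilon_v^{\theta,q},$$ where for $q=2$ the expression $\beta_{-1}(t)\,dt$ is understood as its limit for $r\downarrow-1$, the unit point mass at $t=0$, so that $\Upsilon_v^{\theta,2}$ is the identity map. Then for every $\theta\in\mathbb{R}^J$: 1. For every $j$, the partial derivative exists and $$\frac{\partial}{\partial\theta_j}D_q(\rho\|\sigma_v(\theta))=\langle G_j\rangle_{\Sigma_{v\to vh}^{\theta,q}(\rho^q)}-Q_q(\rho\|\sigma_v(\theta))\,\langle G_j\rangle_{\sigma_{vh}(\theta)}.$$ 2. For $q\neq 2$,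 $\beta_{1-q}$ is a probability density on $\mathbb{R}$; and $\Upsilon_v^{\theta,s}(X)\to\Upsilon_v^{\theta,2}(X)=X$ as $s\uparrow2$, for every operator $X$ on $V$. 3. $\Sigma_{v\to vh}^{\theta,q}$ is linear and Hermiticity preserving. It is not trace preserving if $d_v\ge2$. -/

import Mathlib

open scoped Matrix Kronecker ComplexOrder

noncomputable section

namespace QBM

/-- The high-peak tent density `γ(t) = (2/π) ln |coth (π t / 2)|`. -/
def tentDensity (t : ℝ) : ℝ :=
  2 / Real.pi *
    Real.log |Real.cosh (Real.pi * t / 2) / Real.sinh (Real.pi * t / 2)|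

/-- The density `β_r(t) = sin (π r) / (2 r (cosh (π t) + cos (π r)))`. -/
def betaDensity (r t : ℝ) : ℝ :=
  Real.sin (Real.pi * r) /
    (2 * r * (Real.cosh (Real.pi * t) + Real.cos (Real.pi * r)))

section Matrices

variable {n : Type*} [Fintype n] [DecidableEq n]

/-- Real power `A ^ s` of a positive semidefinite matrix, through the spectral decomposition.
(The only powers used below are positive powers of a state, and arbitrary powers of a
positive definite state.) -/
def rpow (A : Matrix n n ℂ) (s : ℝ) : Matrix n n ℂ :=
  cfc (fun x : ℝ => x ^ s) A

/-- Complex power `A ^ z = e ^ (z ln A)` of a positive definite matrix. -/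
def cpow (A : Matrix n n ℂ) (z : ℂ) : Matrix n n ℂ :=
  NormedSpace.exp (z • cfc Real.log A)

/-- `⟨A⟩_ρ = Tr[A ρ]`. -/
def expect (A ρ : Matrix n n ℂ) : ℂ := (A * ρ).trace

/-- The anticommutator `{A, B} = A B + B A`. -/
def anticomm (A B : Matrix n n ℂ) : Matrix n n ℂ := A * B + B * A

/-- The relative quasi-entropy `Q_q(ρ‖σ) = Tr[ρ ^ q σ ^ (1 - q)]`. -/
def petzQ (q : ℝ) (ρ σ : Matrix n n ℂ) : ℂ := (rpow ρ q * rpow σ (1 - q)).trace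

/-- The Petz--Tsallis relative entropy `D_q(ρ‖σ) = (Q_q(ρ‖σ) - 1) / (q - 1)`. -/
def petzTsallis (q : ℝ) (ρ σ : Matrix n n ℂ) : ℂ := (petzQ q ρ σ - 1) / ((q : ℂ) - 1)

/-- The modular-flow twirl
`X ↦ ∫ β_{1-q}(t) σ ^ (- i t / 2) X σ ^ (i t / 2) dt`, the integral being taken entry by entry.
For `q = 2` the formula for `β_{-1}` degenerates: the measures `β_r(t) dt` converge, as
`r` decreases to `-1`, to the unit mass at `t = 0`, whose twirl is the identity map. -/
def modularTwirl (q : ℝ) (σ X : Matrix n n ℂ) : Matrix n n ℂ :=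
  if q = 2 then X
  else Matrix.of fun a b => ∫ t : ℝ, (betaDensity (1 - q) t : ℂ) *
    (cpow σ (-(Complex.I * t / 2)) * X * cpow σ (Complex.I * t / 2)) a b

/-- `Y ↦ ∫ γ(t) e ^ (- i H t) Y e ^ (i H t) dt`, the integral being taken entry by entry. -/
def tentTwirl (H Y : Matrix n n ℂ) : Matrix n n ℂ :=
  Matrix.of fun a b => ∫ t : ℝ, (tentDensity t : ℂ) *
    (NormedSpace.exp (-(Complex.I * t) • H) * Y * NormedSpace.exp ((Complex.I * t) • H)) a b

end Matrices

section Machine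

variable {V H : Type*} [Fintype V] [DecidableEq V] [Fintype H] [DecidableEq H] {J : ℕ}

/-- The partial trace over the hidden system. -/
def traceHidden (A : Matrix (V × H) (V × H) ℂ) : Matrix V V ℂ :=
  Matrix.of fun a b => ∑ h, A (a, h) (b, h)

/-- `G(θ) = ∑ j, θ_j G_j`. -/
def hamiltonian (G : Fin J → Matrix (V × H) (V × H) ℂ) (θ : Fin J → ℝ) :
    Matrix (V × H) (V × H) ℂ :=
  ∑ j, (θ j : ℂ) • G j

/-- The thermal state `σ_vh(θ) = e ^ (-G(θ)) / Tr[e ^ (-G(θ))]`. -/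
def thermalState (G : Fin J → Matrix (V × H) (V × H) ℂ) (θ : Fin J → ℝ) :
    Matrix (V × H) (V × H) ℂ :=
  (NormedSpace.exp (-hamiltonian G θ)).trace⁻¹ • NormedSpace.exp (-hamiltonian G θ)

/-- The visible state `σ_v(θ) = Tr_h[σ_vh(θ)]`. -/
def visibleState (G : Fin J → Matrix (V × H) (V × H) ℂ) (θ : Fin J → ℝ) : Matrix V V ℂ :=
  traceHidden (thermalState G θ)

/-- `Ξ(R) = ½ {σ_vh(θ), σ_v(θ) ^ (-q/2) R σ_v(θ) ^ (-q/2) ⊗ I_h}`. -/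
def xiMap (G : Fin J → Matrix (V × H) (V × H) ℂ) (θ : Fin J → ℝ) (q : ℝ)
    (R : Matrix V V ℂ) : Matrix (V × H) (V × H) ℂ :=
  (1 / 2 : ℂ) • anticomm (thermalState G θ)
    ((rpow (visibleState G θ) (-q / 2) * R * rpow (visibleState G θ) (-q / 2)) ⊗ₖ
      (1 : Matrix H H ℂ))

/-- `Σ = Φ ∘ Ξ ∘ Υ`, from visible to visible-and-hidden matrices. -/
def sigmaMap (G : Fin J → Matrix (V × H) (V × H) ℂ) (θ : Fin J → ℝ) (q : ℝ)
    (X : Matrix V V ℂ) : Matrix (V × H) (V × H) ℂ :=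
  tentTwirl (hamiltonian G θ) (xiMap G θ q (modularTwirl q (visibleState G θ) X))

end Machine

end QBM

end

noncomputable section

namespace QBM

open MeasureTheory

set_option linter.unusedSectionVars false

/-! ### Partial fractions of the tangent -/

/-! Both integral twirls become Schur multipliers in an eigenbasis. Conjugating by `e^{-itH}`
multiplies the `(i, j)` entry by a phase, so averaging over a density multiplies it by the Fourier
transform of that density at the eigenvalue gap (`integral_twirl`). The transforms are
`tanh(ω/2)/(ω/2)` for the tent density and `sinh(rω)/(r sinh ω)` for `betaDensity r`; both are
computed from exponential series and the partial fractions of the tangent.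

By the Daleckii–Krein formula (`hasDerivAt_cfc`), the derivative of a matrix function is the Schur
multiplier of its divided differences. These factor through the same kernels: those of `e^{-x}` are
an arithmetic mean times the tanh kernel (`dslope_exp_neg`), and those of `x^{1-q}` are a product of
powers `-q/2` times the sinh kernel (`dslope_rpow`). Hence the derivative of the Gibbs state is an
anticommutator with a tent twirl, plus a normalization term. The derivative of the relative entropy
in its second argument pairs the variation with `σ^{-q/2} Υ(ρ^q) σ^{-q/2}`. Both twirls are
self-adjoint for the trace pairing, and the adjoint of the partial trace is `R ↦ R ⊗ 1`. Moving
everything onto `ρ^q` produces `Σ`, while the normalization term gives the `Q_q` summand.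

The same symbols give linearity, preservation of Hermiticity and the limit at order 2. They also
give `Tr Σ(X) = Tr[X σ_v^{1-q}]`. If this were always `Tr X`, then `σ_v = 1`, which has trace `d_v`
and not 1 when `d_v ≥ 2`. -/

/-- The partial fraction expansion of the tangent. -/
theorem hasSum_tan {w : ℂ} (hw : w ∈ Complex.integerComplement) :
    HasSum (fun m : ℕ => 1 / ((2 * m + 1 : ℂ) - w) - 1 / ((2 * m + 1 : ℂ) + w))
      (Real.pi / 2 * Complex.tan (Real.pi * w / 2)) := by
  have hw2 : w / 2 ∈ Complex.integerComplement := by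
    rintro ⟨k, hk⟩
    exact hw ⟨2 * k, by push_cast; rw [hk]; ring⟩
  have hsum := summable_cotTerm hw
  have h1 : HasSum (fun n => cotTerm w n) (Real.pi * Complex.cot (Real.pi * w) - 1 / w) := by
    rw [cot_series_rep' hw]
    exact hsum.hasSum
  have h2 : HasSum (fun n => cotTerm (w / 2) n)
      (Real.pi * Complex.cot (Real.pi * (w / 2)) - 1 / (w / 2)) := by
    rw [cot_series_rep' hw2]
    exact (summable_cotTerm hw2).hasSum
  -- `cotTerm w n` has its poles at `±(n + 1)`, so odd indices carry the even integers, and these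
  -- terms form half the cotangent series at `w / 2`. The even indices then give the tangent through
  -- `2 cot 2x = cot x - tan x`.
  have hodd : HasSum (fun m : ℕ => cotTerm w (2 * m + 1))
      (1 / 2 * (Real.pi * Complex.cot (Real.pi * (w / 2)) - 1 / (w / 2))) := by
    refine (h2.mul_left (1 / 2)).congr_fun ?_
    intro m
    have e1 : w - ((2 * m + 1 : ℕ) + 1) ≠ 0 := fun h =>
      hw ⟨2 * m + 1 + 1, by push_cast at h ⊢; linear_combination -h⟩
    have e2 : w + ((2 * m + 1 : ℕ) + 1) ≠ 0 := fun h =>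
      hw ⟨-(2 * m + 1 + 1), by push_cast at h ⊢; linear_combination -h⟩
    have e3 : w / 2 - (m + 1) ≠ 0 := fun h => e1 (by push_cast; linear_combination 2 * h)
    have e4 : w / 2 + (m + 1) ≠ 0 := fun h => e2 (by push_cast; linear_combination 2 * h)
    have e5 : w - ((2 * m + 1 : ℕ) + 1) = 2 * (w / 2 - (m + 1)) := by push_cast; ring
    have e6 : w + ((2 * m + 1 : ℕ) + 1) = 2 * (w / 2 + (m + 1)) := by push_cast; ring
    simp only [cotTerm, e5, e6]
    field_simp
  have heven : HasSum (fun m : ℕ => cotTerm w (2 * m)) (∑' m : ℕ, cotTerm w (2 * m)) :=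
    (hsum.comp_injective (mul_right_injective₀ (two_ne_zero' ℕ))).hasSum
  have hval := h1.unique (heven.even_add_odd hodd)
  have hs : Complex.sin (Real.pi * w / 2) ≠ 0 := by
    rw [Complex.sin_ne_zero_iff]
    intro k hk
    have hpi : (Real.pi : ℂ) ≠ 0 := by exact_mod_cast Real.pi_ne_zero
    refine hw2 ⟨k, mul_left_cancel₀ hpi ?_⟩
    linear_combination -hk
  have hc : Complex.cos (Real.pi * w / 2) ≠ 0 := by
    rw [Complex.cos_ne_zero_iff]
    intro k hk
    have hpi : (Real.pi : ℂ) ≠ 0 := by exact_mod_cast Real.pi_ne_zero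
    refine hw ⟨2 * k + 1, mul_left_cancel₀ hpi ?_⟩
    push_cast
    linear_combination -2 * hk
  have htan : Real.pi / 2 * Complex.tan (Real.pi * w / 2) = -∑' m : ℕ, cotTerm w (2 * m) := by
    have hd : (Real.pi * w : ℂ) = 2 * (Real.pi * w / 2) := by ring
    have hd' : (Real.pi * (w / 2) : ℂ) = Real.pi * w / 2 := by ring
    rw [hd, hd', Complex.cot, Complex.cot, Complex.sin_two_mul, Complex.cos_two_mul'] at hval
    rw [Complex.tan_eq_sin_div_cos]
    have := eq_sub_of_add_eq hval.symm
    rw [this]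
    field_simp
    ring
  rw [htan]
  refine heven.neg.congr_fun ?_
  intro m
  have e1 : w - (((2 * m : ℕ) : ℂ) + 1) = -((2 * m + 1 : ℂ) - w) := by push_cast; ring
  have e2 : w + (((2 * m : ℕ) : ℂ) + 1) = (2 * m + 1 : ℂ) + w := by push_cast; ring
  rw [cotTerm, e1, e2, one_div, one_div, one_div, inv_neg]
  ring

/-! ### Fourier transforms -/

theorem integrable_exp_neg_mul_abs_mul_cexp {a : ℝ} (ha : 0 < a) (ω : ℝ) :
    Integrable fun t : ℝ =>
      (Real.exp (-a * |t|) : ℂ) * Complex.exp (-(Complex.I * t * ω)) := by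
  rw [← integrableOn_univ, ← Set.Iic_union_Ioi (a := (0 : ℝ))]
  refine IntegrableOn.union ?_ ?_
  · refine (integrableOn_exp_mul_complex_Iic (a := a - Complex.I * ω) (by simpa) 0).congr_fun
      (fun t ht => ?_) measurableSet_Iic
    rw [Complex.ofReal_exp, ← Complex.exp_add, abs_of_nonpos ht]
    push_cast
    ring_nf
  · refine (integrableOn_exp_mul_complex_Ioi (a := -a - Complex.I * ω) (by simpa) 0).congr_fun
      (fun t ht => ?_) measurableSet_Ioi
    rw [Complex.ofReal_exp, ← Complex.exp_add, abs_of_pos ht]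
    push_cast
    ring_nf

theorem integral_exp_neg_mul_abs_mul_cexp {a : ℝ} (ha : 0 < a) (ω : ℝ) :
    ∫ t : ℝ, (Real.exp (-a * |t|) : ℂ) * Complex.exp (-(Complex.I * t * ω)) =
      1 / (a - Complex.I * ω) + 1 / (a + Complex.I * ω) := by
  have hi := integrable_exp_neg_mul_abs_mul_cexp ha ω
  rw [← intervalIntegral.integral_Iic_add_Ioi (b := 0) hi.integrableOn hi.integrableOn]
  congr 1
  · have h := integral_exp_mul_complex_Iic (a := a - Complex.I * ω) (by simpa) 0
    simp only [Complex.ofReal_zero, mul_zero, Complex.exp_zero] at h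
    rw [← h]
    refine setIntegral_congr_fun measurableSet_Iic fun t ht => ?_
    rw [Complex.ofReal_exp, ← Complex.exp_add, abs_of_nonpos ht]
    congr 1
    push_cast
    ring
  · have h := integral_exp_mul_complex_Ioi (a := -(a + Complex.I * ω)) (by simpa) 0
    simp only [Complex.ofReal_zero, mul_zero, Complex.exp_zero, neg_div_neg_eq] at h
    rw [← h]
    refine setIntegral_congr_fun measurableSet_Ioi fun t ht => ?_
    rw [Complex.ofReal_exp, ← Complex.exp_add, abs_of_pos ht]
    congr 1
    push_cast
    ring

theorem integral_exp_neg_mul_abs {a : ℝ} (ha : 0 < a) :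
    ∫ t : ℝ, Real.exp (-a * |t|) = 2 / a := by
  have h := integral_exp_neg_mul_abs_mul_cexp ha 0
  simp only [Complex.ofReal_zero, mul_zero, neg_zero, Complex.exp_zero, mul_one, sub_zero,
    add_zero] at h
  rw [integral_complex_ofReal] at h
  refine Complex.ofReal_injective (h.trans ?_)
  push_cast
  ring

theorem norm_cexp_neg_I_mul (t ω : ℝ) : ‖Complex.exp (-(Complex.I * t * ω))‖ = 1 := by
  rw [Complex.norm_exp]
  simp

/-- The function `tanh (ω / 2) / (ω / 2)`, the Fourier transform of the tent density. -/
def tanhKernel (ω : ℝ) : ℝ := if ω = 0 then 1 else Real.tanh (ω / 2) / (ω / 2)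

/-- The function `sinh (r ω) / (r sinh ω)`, the Fourier transform of `betaDensity r`. -/
def sinhKernel (r ω : ℝ) : ℝ := if ω = 0 then 1 else Real.sinh (r * ω) / (r * Real.sinh ω)

/-- With `y = e^{-π|t|}` one has `coth(π|t|/2) = (1 + y)/(1 - y)`, whose logarithm is an odd power
series in `y`. -/
theorem tentDensity_hasSum {t : ℝ} (ht : t ≠ 0) :
    HasSum (fun m : ℕ => 4 / (Real.pi * (2 * m + 1)) *
      Real.exp (-((2 * m + 1) * Real.pi) * |t|)) (tentDensity t) := by
  have hpos : 0 < Real.pi * |t| := mul_pos Real.pi_pos (abs_pos.2 ht)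
  set y := Real.exp (-(Real.pi * |t|)) with hy
  have hy0 : 0 < y := Real.exp_pos _
  have hy1 : y < 1 := Real.exp_lt_one_iff.2 (by linarith)
  have hs := (Real.hasSum_log_sub_log_of_abs_lt_one (x := y)
    (by rw [abs_of_pos hy0]; exact hy1)).mul_left (2 / Real.pi)
  have hval : tentDensity t = 2 / Real.pi * (Real.log (1 + y) - Real.log (1 - y)) := by
    rw [tentDensity, ← Real.log_div (by linarith) (by linarith)]
    congr 2
    rw [abs_div, Real.abs_sinh, abs_of_pos (Real.cosh_pos _), ← Real.cosh_abs, abs_div, abs_mul,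
      abs_of_pos Real.pi_pos, abs_two]
    have hy' : y = Real.exp (-(Real.pi * |t| / 2)) * Real.exp (-(Real.pi * |t| / 2)) := by
      rw [← Real.exp_add, hy]; congr 1; ring
    have hsp : 0 < Real.sinh (Real.pi * |t| / 2) := Real.sinh_pos_iff.2 (by linarith)
    rw [div_eq_div_iff hsp.ne' (by linarith), Real.cosh_eq, Real.sinh_eq, hy']
    have hmul : Real.exp (Real.pi * |t| / 2) * Real.exp (-(Real.pi * |t| / 2)) = 1 := by
      rw [← Real.exp_add]; simp
    linear_combination (-Real.exp (-(Real.pi * |t| / 2))) * hmul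
  rw [hval]
  refine hs.congr_fun fun m => ?_
  have : y ^ (2 * m + 1) = Real.exp (-((2 * m + 1) * Real.pi) * |t|) := by
    rw [hy, ← Real.exp_nat_mul]
    congr 1
    push_cast
    ring
  rw [this]
  have := Real.pi_ne_zero
  field_simp
  ring

theorem hasSum_one_div_odd_sq :
    HasSum (fun m : ℕ => 1 / (2 * m + 1 : ℝ) ^ 2) (Real.pi ^ 2 / 8) := by
  obtain ⟨f, hf⟩ : ∃ f : ℕ → ℝ, f = fun n : ℕ => 1 / (n : ℝ) ^ 2 := ⟨_, rfl⟩
  have h2 : HasSum f (Real.pi ^ 2 / 6) := hf ▸ hasSum_zeta_two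
  have he : HasSum (fun m => f (2 * m)) (1 / 4 * (Real.pi ^ 2 / 6)) := by
    refine (h2.mul_left (1 / 4)).congr_fun fun m => ?_
    rw [hf]
    push_cast
    rw [mul_pow, one_div, one_div, one_div, mul_inv]
    norm_num
  have hinj : Function.Injective fun m : ℕ => 2 * m + 1 := fun a b h => by
    simp only at h
    omega
  have ho : HasSum (fun m => f (2 * m + 1)) (∑' m, f (2 * m + 1)) :=
    (h2.summable.comp_injective hinj).hasSum
  have hv := h2.unique (he.even_add_odd ho)
  have hv' : ∑' m, f (2 * m + 1) = Real.pi ^ 2 / 8 := by linear_combination -hv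
  rw [hv'] at ho
  refine ho.congr_fun fun m => ?_
  rw [hf]
  push_cast
  ring

/-- The tangent expansion at the imaginary point `iω/π` turns into one of tanh; at `ω = 0` it is
replaced by the sum of inverse odd squares. -/
theorem hasSum_tanhKernel (ω : ℝ) :
    HasSum (fun m : ℕ => (8 / (((2 * m + 1) * Real.pi) ^ 2 + ω ^ 2) : ℂ)) (tanhKernel ω) := by
  have hpi : (Real.pi : ℂ) ≠ 0 := by exact_mod_cast Real.pi_ne_zero
  by_cases hω : ω = 0
  · subst hω
    have h := (Complex.hasSum_ofReal.2 hasSum_one_div_odd_sq).mul_left (8 / (Real.pi : ℂ) ^ 2)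
    have e : (8 / (Real.pi : ℂ) ^ 2) * ((Real.pi ^ 2 / 8 : ℝ) : ℂ) = (tanhKernel 0 : ℝ) := by
      simp only [tanhKernel, if_true]
      push_cast
      field_simp
    rw [← e]
    refine h.congr_fun fun m => ?_
    push_cast
    simp only [ne_eq, OfNat.ofNat_ne_zero, not_false_eq_true, zero_pow, add_zero, mul_pow]
    rw [div_mul_div_comm, mul_one, mul_comm]
  · have hωc : (ω : ℂ) ≠ 0 := by exact_mod_cast hω
    have hIc : Complex.I * ω / Real.pi = ((ω / Real.pi : ℝ) : ℂ) * Complex.I := by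
      push_cast; ring
    have hw : Complex.I * ω / Real.pi ∈ Complex.integerComplement := by
      rintro ⟨k, hk⟩
      rw [hIc] at hk
      have := congrArg Complex.im hk
      simp only [Complex.intCast_im, Complex.im_ofReal_mul, Complex.I_im, mul_one] at this
      exact div_ne_zero hω Real.pi_ne_zero this.symm
    have h := (hasSum_tan hw).mul_left (4 / (Complex.I * ω * Real.pi))
    have e : 4 / (Complex.I * ω * Real.pi) *
        (Real.pi / 2 * Complex.tan (Real.pi * (Complex.I * ω / Real.pi) / 2)) =
        (tanhKernel ω : ℝ) := by
      have : Real.pi * (Complex.I * ω / Real.pi) / 2 = (ω / 2 : ℂ) * Complex.I := by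
        field_simp
      rw [this, Complex.tan_mul_I, tanhKernel, if_neg hω]
      push_cast
      have := Complex.I_ne_zero
      field_simp
      ring
    rw [← e]
    refine h.congr_fun fun m => ?_
    have hre : ∀ s : ℂ, s = Complex.I * ω / Real.pi ∨ s = -(Complex.I * ω / Real.pi) →
        (2 * m + 1 : ℂ) + s ≠ 0 := by
      rintro s (rfl | rfl) h0 <;>
      · rw [hIc] at h0
        have := congrArg Complex.im h0
        simp [Real.pi_ne_zero, hω] at this
    have h1 := hre _ (Or.inl rfl)
    have h2 := hre _ (Or.inr rfl)
    rw [← sub_eq_add_neg] at h2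
    have hprod : ((2 * m + 1) * Real.pi : ℂ) ^ 2 + ω ^ 2 =
        Real.pi ^ 2 * (((2 * m + 1 : ℂ) + Complex.I * ω / Real.pi) *
          ((2 * m + 1 : ℂ) - Complex.I * ω / Real.pi)) := by
      field_simp
      linear_combination ((ω : ℂ) ^ 2) * Complex.I_sq
    rw [hprod, div_sub_div _ _ h2 h1, div_mul_div_comm]
    have := Complex.I_ne_zero
    rw [div_eq_div_iff (mul_ne_zero (pow_ne_zero 2 hpi) (mul_ne_zero h1 h2))
      (mul_ne_zero (mul_ne_zero (mul_ne_zero this hωc) hpi) (mul_ne_zero h2 h1))]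
    field_simp
    ring

/-- The Fourier transform of the high-peak tent density. -/
theorem integral_tentDensity_mul_cexp (ω : ℝ) :
    ∫ t : ℝ, (tentDensity t : ℂ) * Complex.exp (-(Complex.I * t * ω)) = tanhKernel ω := by
  have hpi : (Real.pi : ℂ) ≠ 0 := by exact_mod_cast Real.pi_ne_zero
  have ha : ∀ m : ℕ, (0 : ℝ) < (2 * m + 1) * Real.pi := fun m => by positivity
  let F : ℕ → ℝ → ℂ := fun m t => ((4 / (Real.pi * (2 * m + 1)) : ℝ) : ℂ) *
    ((Real.exp (-((2 * m + 1) * Real.pi) * |t|) : ℂ) * Complex.exp (-(Complex.I * t * ω)))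
  have hF : ∀ m, Integrable (F m) := fun m =>
    (integrable_exp_neg_mul_abs_mul_cexp (ha m) ω).const_mul _
  -- Sum and integral may be exchanged because the `L¹` norms are `8/π²` times the inverse odd
  -- squares.
  have hFn : Summable fun m => ∫ t, ‖F m t‖ := by
    refine (hasSum_one_div_odd_sq.summable.mul_left (8 / Real.pi ^ 2)).congr fun m => ?_
    have : ∀ t, ‖F m t‖ = 4 / (Real.pi * (2 * m + 1)) *
        Real.exp (-((2 * m + 1) * Real.pi) * |t|) := fun t => by
      simp only [F]
      rw [norm_mul, norm_mul, norm_cexp_neg_I_mul, mul_one, Complex.norm_real, Complex.norm_real,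
        Real.norm_of_nonneg (by positivity), Real.norm_of_nonneg (by positivity)]
    simp_rw [this]
    rw [integral_const_mul, integral_exp_neg_mul_abs (ha m)]
    field_simp
    ring
  have h := hasSum_integral_of_summable_integral_norm hF hFn
  have h1 : ∫ t : ℝ, (tentDensity t : ℂ) * Complex.exp (-(Complex.I * t * ω)) =
      ∫ t, ∑' m, F m t := by
    refine integral_congr_ae ?_
    filter_upwards [compl_mem_ae_iff.2 (measure_singleton (0 : ℝ))] with t ht
    have := (Complex.hasSum_ofReal.2 (tentDensity_hasSum ht)).mul_right
      (Complex.exp (-(Complex.I * t * ω)))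
    rw [← this.tsum_eq]
    refine tsum_congr fun m => ?_
    simp only [F]
    push_cast
    ring
  rw [h1]
  refine h.unique ((hasSum_tanhKernel ω).congr_fun fun m => ?_)
  simp only [F]
  rw [integral_const_mul, integral_exp_neg_mul_abs_mul_cexp (ha m)]
  have hre : ∀ s : ℝ, (((2 * m + 1) * Real.pi : ℝ) : ℂ) + Complex.I * s ≠ 0 := fun s h0 => by
    have := congrArg Complex.re h0
    simp only [Complex.add_re, Complex.ofReal_re, Complex.mul_re, Complex.I_re, Complex.I_im,
      Complex.ofReal_im, Complex.zero_re] at this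
    linarith [ha m]
  have h1 := hre ω
  have h2 := hre (-ω)
  have h2' : (((2 * m + 1) * Real.pi : ℝ) : ℂ) - Complex.I * ω ≠ 0 := by
    intro h; apply h2; push_cast at h ⊢; linear_combination h
  have hprod : ((2 * m + 1) * Real.pi : ℂ) ^ 2 + ω ^ 2 =
      ((((2 * m + 1) * Real.pi : ℝ) : ℂ) - Complex.I * ω) *
      ((((2 * m + 1) * Real.pi : ℝ) : ℂ) + Complex.I * ω) := by
    push_cast
    linear_combination ((ω : ℂ) ^ 2) * Complex.I_sq
  have hm : (2 * m + 1 : ℂ) ≠ 0 := by exact_mod_cast Nat.succ_ne_zero (2 * m)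
  rw [div_add_div _ _ h2' h1, hprod]
  push_cast
  rw [div_mul_div_comm, mul_comm (_ : ℂ) (_ * _), div_mul_eq_div_div]
  push_cast at h1 h2'
  field_simp
  ring

theorem sinhKernel_zero (r : ℝ) : sinhKernel r 0 = 1 := if_pos rfl

theorem tanhKernel_zero : tanhKernel 0 = 1 := if_pos rfl

theorem sinhKernel_neg (r ω : ℝ) : sinhKernel r (-ω) = sinhKernel r ω := by
  simp only [sinhKernel, neg_eq_zero, mul_neg, Real.sinh_neg, neg_div_neg_eq]

theorem sinhKernel_neg_left (r ω : ℝ) : sinhKernel (-r) ω = sinhKernel r ω := by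
  simp only [sinhKernel, neg_mul, Real.sinh_neg, neg_div_neg_eq]

theorem tanhKernel_neg (ω : ℝ) : tanhKernel (-ω) = tanhKernel ω := by
  simp only [tanhKernel, neg_eq_zero, neg_div 2 ω, Real.tanh_neg, neg_div_neg_eq]

theorem betaDensity_neg_left (r t : ℝ) : betaDensity (-r) t = betaDensity r t := by
  simp only [betaDensity, mul_neg, neg_mul, Real.sin_neg, Real.cos_neg, neg_div_neg_eq]

/-- The singularity at 0 is removable: the kernel is a quotient of difference quotients based at 0.
Fourier inversion needs this continuity. -/
theorem continuous_sinhKernel {r : ℝ} (hr : r ≠ 0) : Continuous (sinhKernel r) := by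
  have hd : DifferentiableAt ℝ (fun x => Real.sinh (r * x)) 0 := by fun_prop
  have hderiv : deriv (fun x => Real.sinh (r * x)) 0 = r := by
    have := ((hasDerivAt_id (0 : ℝ)).const_mul r).sinh
    simpa using this.deriv
  have hc1 : Continuous (dslope (fun x => Real.sinh (r * x)) 0) := by
    rw [← continuousOn_univ, continuousOn_dslope Filter.univ_mem]
    exact ⟨by fun_prop, hd⟩
  have hc2 : Continuous (dslope Real.sinh 0) := by
    rw [← continuousOn_univ, continuousOn_dslope Filter.univ_mem]
    exact ⟨by fun_prop, by fun_prop⟩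
  have hne : ∀ x, r * dslope Real.sinh 0 x ≠ 0 := by
    intro x
    refine mul_ne_zero hr ?_
    by_cases hx : x = 0
    · subst hx; simp
    · rw [dslope_of_ne _ hx, slope_def_field]
      simp [hx]
  refine (hc1.div (continuous_const.mul hc2) hne).congr fun x => ?_
  rw [Pi.div_apply, Pi.mul_apply]
  by_cases hx : x = 0
  · subst hx
    rw [dslope_same, dslope_same, hderiv, sinhKernel_zero]
    simp [hr]
  · rw [dslope_of_ne _ hx, dslope_of_ne _ hx, slope_def_field, slope_def_field, sinhKernel,
      if_neg hx]
    have : Real.sinh x ≠ 0 := by simpa using hx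
    simp
    field_simp

/-- Expand `1 / sinh x` as a geometric series in `e^{-2x}`. -/
theorem hasSum_sinhKernel (r : ℝ) {ω : ℝ} (hω : ω ≠ 0) :
    HasSum (fun k : ℕ => 1 / r * (Real.exp (-(2 * k + 1 - r) * |ω|) -
      Real.exp (-(2 * k + 1 + r) * |ω|))) (sinhKernel r ω) := by
  have hx : 0 < |ω| := abs_pos.2 hω
  have heven : sinhKernel r ω = sinhKernel r |ω| := by
    rcases abs_choice ω with h | h <;> rw [h]
    rw [sinhKernel_neg]
  rw [heven]
  generalize |ω| = x at hx
  have hq : Real.exp (-2 * x) < 1 := Real.exp_lt_one_iff.2 (by linarith)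
  have h := (hasSum_geometric_of_lt_one (Real.exp_pos _).le hq).mul_left
    (1 / r * ((Real.exp (r * x) - Real.exp (-(r * x))) * Real.exp (-x)))
  have hval : 1 / r * ((Real.exp (r * x) - Real.exp (-(r * x))) * Real.exp (-x)) *
      (1 - Real.exp (-2 * x))⁻¹ = sinhKernel r x := by
    have hs : Real.sinh x ≠ 0 := by simpa using hx.ne'
    have h1 : 1 - Real.exp (-2 * x) = 2 * Real.sinh x * Real.exp (-x) := by
      rw [Real.sinh_eq]
      have e1 : Real.exp (-2 * x) = Real.exp (-x) * Real.exp (-x) := by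
        rw [← Real.exp_add]; ring_nf
      have e2 : Real.exp x * Real.exp (-x) = 1 := by rw [← Real.exp_add]; simp
      rw [e1]
      linear_combination -e2
    have h2 : Real.exp (r * x) - Real.exp (-(r * x)) = 2 * Real.sinh (r * x) := by
      rw [Real.sinh_eq]; ring
    rw [sinhKernel, if_neg hx.ne', h1, h2]
    have := (Real.exp_pos (-x)).ne'
    by_cases hr : r = 0
    · simp [hr]
    · field_simp
  rw [hval] at h
  refine h.congr_fun fun k => ?_
  rw [mul_assoc, ← Real.exp_nat_mul, mul_assoc, ← Real.exp_add, sub_mul, ← Real.exp_add,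
    ← Real.exp_add]
  ring_nf

theorem add_mul_I_mem_integerComplement {r : ℝ} (h0 : 0 < r) (h1 : r < 1) (t : ℝ) :
    (r + Complex.I * t : ℂ) ∈ Complex.integerComplement := by
  rintro ⟨k, hk⟩
  have := congrArg Complex.re hk
  simp at this
  have hk0 : 0 < k := by exact_mod_cast (by linarith : (0 : ℝ) < k)
  have hk1 : k < 1 := by exact_mod_cast (by linarith : (k : ℝ) < 1)
  omega

theorem cosh_add_cos_pos {r : ℝ} (h1 : |r| < 1) (t : ℝ) :
    0 < Real.cosh (Real.pi * t) + Real.cos (Real.pi * r) := by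
  have hc : -1 < Real.cos (Real.pi * r) := by
    rw [← Real.cos_abs, ← Real.cos_pi, abs_mul, abs_of_pos Real.pi_pos]
    refine Real.cos_lt_cos_of_nonneg_of_le_pi (by positivity) le_rfl ?_
    nlinarith [Real.pi_pos]
  linarith [Real.one_le_cosh (Real.pi * t)]

theorem betaDensity_nonneg {r : ℝ} (h1 : |r| < 1) (t : ℝ) : 0 ≤ betaDensity r t := by
  wlog hr : 0 ≤ r generalizing r
  · rw [← betaDensity_neg_left]
    exact this (by rwa [abs_neg]) (by linarith)
  have := cosh_add_cos_pos h1 t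
  rw [abs_of_nonneg hr] at h1
  refine div_nonneg (Real.sin_nonneg_of_nonneg_of_le_pi (by positivity) ?_) (by positivity)
  nlinarith [Real.pi_pos]

/-- For the two half-angles `A`, `B`, the sum is `sin(A + B) / (cos A cos B)`, where `A + B = πr`
and `A - B = iπt`. -/
theorem tan_add_tan_conj {r : ℝ} (h1 : |r| < 1) (t : ℝ) :
    Complex.tan (Real.pi * (r + Complex.I * t) / 2) +
      Complex.tan (Real.pi * (r + Complex.I * (-t : ℝ)) / 2) =
      ((2 * Real.sin (Real.pi * r) / (Real.cosh (Real.pi * t) + Real.cos (Real.pi * r)) : ℝ) : ℂ) := by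
  set A : ℂ := Real.pi * (r + Complex.I * t) / 2 with hA
  set B : ℂ := Real.pi * (r + Complex.I * (-t : ℝ)) / 2 with hB
  have hsum : A + B = (Real.pi * r : ℝ) := by rw [hA, hB]; push_cast; ring
  have hdiff : A - B = (Real.pi * t : ℝ) * Complex.I := by rw [hA, hB]; push_cast; ring
  have hsin : Complex.sin A * Complex.cos B + Complex.cos A * Complex.sin B =
      (Real.sin (Real.pi * r) : ℝ) := by
    rw [← Complex.sin_add, hsum, Complex.ofReal_sin]
  have hcos : 2 * (Complex.cos A * Complex.cos B) =
      ((Real.cosh (Real.pi * t) + Real.cos (Real.pi * r) : ℝ) : ℂ) := by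
    have e1 := Complex.cos_add A B
    have e2 := Complex.cos_sub A B
    rw [hsum] at e1
    rw [hdiff, Complex.cos_mul_I] at e2
    rw [Complex.ofReal_add, Complex.ofReal_cosh, Complex.ofReal_cos, e1, e2]
    ring
  have hne : ((Real.cosh (Real.pi * t) + Real.cos (Real.pi * r) : ℝ) : ℂ) ≠ 0 := by
    exact_mod_cast (cosh_add_cos_pos h1 t).ne'
  have hAB : Complex.cos A * Complex.cos B ≠ 0 := by
    intro h
    rw [h, mul_zero] at hcos
    exact hne hcos.symm
  have hcA := left_ne_zero_of_mul hAB
  have hcB := right_ne_zero_of_mul hAB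
  rw [Complex.tan_eq_sin_div_cos, Complex.tan_eq_sin_div_cos, div_add_div _ _ hcA hcB, hsin,
    Complex.ofReal_div, Complex.ofReal_mul, ← hcos]
  push_cast
  field_simp

/-- This is the direction opposite to the one finally needed: the kernel is a sum of exponentials,
so its transform can be taken term by term and summed by the tangent series at `r ± it`. Inversion
then gives the transform of the density. -/
theorem integral_sinhKernel_mul_cexp {r : ℝ} (h0 : 0 < r) (h1 : r < 1) (t : ℝ) :
    ∫ ω : ℝ, (sinhKernel r ω : ℂ) * Complex.exp (-(Complex.I * ω * t)) =
      ((2 * Real.pi * betaDensity r t : ℝ) : ℂ) := by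
  have ha : ∀ k : ℕ, (0 : ℝ) < 2 * k + 1 - r := fun k => by
    have : (0 : ℝ) ≤ k := k.cast_nonneg
    linarith
  have hb : ∀ k : ℕ, (0 : ℝ) < 2 * k + 1 + r := fun k => by positivity
  let F : ℕ → ℝ → ℂ := fun k ω => ((1 / r : ℝ) : ℂ) *
    ((Real.exp (-(2 * k + 1 - r) * |ω|) : ℂ) * Complex.exp (-(Complex.I * ω * t)) -
      (Real.exp (-(2 * k + 1 + r) * |ω|) : ℂ) * Complex.exp (-(Complex.I * ω * t)))
  have hF : ∀ k, Integrable (F k) := fun k =>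
    ((integrable_exp_neg_mul_abs_mul_cexp (ha k) t).sub
      (integrable_exp_neg_mul_abs_mul_cexp (hb k) t)).const_mul _
  have hreal : ∀ {a : ℝ}, 0 < a → Integrable fun ω : ℝ => Real.exp (-a * |ω|) := fun {a} h => by
    have := (integrable_exp_neg_mul_abs_mul_cexp h 0).re
    refine this.congr (Filter.Eventually.of_forall fun ω => ?_)
    simp only [Complex.ofReal_zero, mul_zero, neg_zero, Complex.exp_zero, mul_one,
      RCLike.re_to_complex, Complex.ofReal_re]
  have hFn : Summable fun k => ∫ ω, ‖F k ω‖ := by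
    -- The `L¹` norms are, up to a constant, the terms of the tangent series at the real point `r`,
    -- so its convergence gives the bound.
    have hw : (r : ℂ) ∈ Complex.integerComplement := by
      simpa using add_mul_I_mem_integerComplement h0 h1 0
    have h := ((hasSum_tan hw).summable.mul_left (2 / r : ℂ)).norm
    refine h.congr fun k => ?_
    have hn : ∀ ω, ‖F k ω‖ = 1 / r * (Real.exp (-(2 * k + 1 - r) * |ω|) -
        Real.exp (-(2 * k + 1 + r) * |ω|)) := fun ω => by
      simp only [F]
      rw [← sub_mul, norm_mul, norm_mul, norm_cexp_neg_I_mul, mul_one, ← Complex.ofReal_sub,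
        Complex.norm_real, Complex.norm_real, Real.norm_of_nonneg (by positivity),
        Real.norm_of_nonneg]
      rw [sub_nonneg, Real.exp_le_exp]
      nlinarith [abs_nonneg ω]
    simp_rw [hn]
    rw [integral_const_mul, integral_sub (hreal (ha k)) (hreal (hb k)),
      integral_exp_neg_mul_abs (ha k), integral_exp_neg_mul_abs (hb k)]
    have e : (2 / r : ℂ) * (1 / ((2 * k + 1 : ℂ) - r) - 1 / ((2 * k + 1 : ℂ) + r)) =
      ((1 / r * (2 / (2 * k + 1 - r) - 2 / (2 * k + 1 + r)) : ℝ) : ℂ) := by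
      push_cast
      ring
    rw [e, Complex.norm_real, Real.norm_of_nonneg]
    refine mul_nonneg (by positivity) (sub_nonneg.2 ?_)
    exact div_le_div_of_nonneg_left (by norm_num) (ha k) (by linarith)
  have h := hasSum_integral_of_summable_integral_norm hF hFn
  have h2 : ∫ ω : ℝ, (sinhKernel r ω : ℂ) * Complex.exp (-(Complex.I * ω * t)) =
      ∫ ω, ∑' k, F k ω := by
    refine integral_congr_ae ?_
    filter_upwards [compl_mem_ae_iff.2 (measure_singleton (0 : ℝ))] with ω hω
    have := (Complex.hasSum_ofReal.2 (hasSum_sinhKernel r hω)).mul_right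
      (Complex.exp (-(Complex.I * ω * t)))
    rw [← this.tsum_eq]
    refine tsum_congr fun k => ?_
    simp only [F]
    push_cast
    ring
  rw [h2]
  have hlim := ((hasSum_tan (add_mul_I_mem_integerComplement h0 h1 t)).add
    (hasSum_tan (add_mul_I_mem_integerComplement h0 h1 (-t)))).mul_left (1 / r : ℂ)
  have hr1 : |r| < 1 := by rwa [abs_of_pos h0]
  rw [← mul_add, tan_add_tan_conj hr1] at hlim
  have e : (1 / r : ℂ) * (Real.pi / 2 * ((2 * Real.sin (Real.pi * r) /
      (Real.cosh (Real.pi * t) + Real.cos (Real.pi * r)) : ℝ) : ℂ)) =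
      ((2 * Real.pi * betaDensity r t : ℝ) : ℂ) := by
    have h3 := (cosh_add_cos_pos hr1 t).ne'
    rw [betaDensity]
    norm_cast
    have := h0.ne'
    field_simp
  rw [e] at hlim
  refine h.unique (hlim.congr_fun fun k => ?_)
  simp only [F]
  rw [integral_const_mul, integral_sub (integrable_exp_neg_mul_abs_mul_cexp (ha k) t)
    (integrable_exp_neg_mul_abs_mul_cexp (hb k) t), integral_exp_neg_mul_abs_mul_cexp (ha k),
    integral_exp_neg_mul_abs_mul_cexp (hb k)]
  push_cast
  ring_nf

theorem integrable_betaDensity {r : ℝ} (h1 : |r| < 1) : Integrable (betaDensity r) := by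
  have hpos := cosh_add_cos_pos h1
  have hc0 : 0 < 1 + Real.cos (Real.pi * r) := by simpa using hpos 0
  have hcont : Continuous (betaDensity r) := by
    by_cases hr : r = 0
    · subst hr
      have : betaDensity 0 = fun _ => 0 := by ext t; simp [betaDensity]
      rw [this]
      exact continuous_const
    refine Continuous.div (by fun_prop) (by fun_prop) fun t => ?_
    exact mul_ne_zero (mul_ne_zero two_ne_zero hr) (hpos t).ne'
  set c := Real.cos (Real.pi * r)
  refine (integrable_inv_one_add_sq.const_mul
    (|Real.sin (Real.pi * r) / (2 * r)| * (2 / (1 + c)))).mono' hcont.aestronglyMeasurable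
    (Filter.Eventually.of_forall fun t => ?_)
  -- Quadratic growth of the denominator suffices to dominate the density by a multiple of `1 / (1 +
  -- t²)`.
  have hcosh : 1 + t ^ 2 ≤ Real.cosh (Real.pi * t) := by
    have e : Real.cosh (Real.pi * t) = 1 + 2 * Real.sinh (Real.pi * t / 2) ^ 2 := by
      have := Real.cosh_two_mul (Real.pi * t / 2)
      rw [Real.cosh_sq, mul_div_cancel₀ _ (two_ne_zero' ℝ)] at this
      linarith
    have hs : (Real.pi * t / 2) ^ 2 ≤ Real.sinh (Real.pi * t / 2) ^ 2 := by
      rw [sq_le_sq, Real.abs_sinh]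
      exact Real.self_le_sinh_iff.2 (abs_nonneg _)
    rw [e]
    nlinarith [Real.pi_gt_three, sq_nonneg t, mul_nonneg (sq_nonneg t) (sub_nonneg.2 Real.pi_gt_three.le)]
  have hle : (1 + c) / 2 * (1 + t ^ 2) ≤ Real.cosh (Real.pi * t) + c := by
    have : c ≤ 1 := Real.cos_le_one _
    nlinarith [sq_nonneg t]
  rw [betaDensity, ← div_div, Real.norm_eq_abs, abs_div, abs_of_pos (hpos t), mul_assoc,
    div_eq_mul_inv]
  refine mul_le_mul_of_nonneg_left ?_ (abs_nonneg _)
  rw [← inv_div, ← mul_inv]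
  exact inv_anti₀ (by positivity) hle

/-- The Fourier transform of `betaDensity r`. -/
theorem integral_betaDensity_mul_cexp {r : ℝ} (hr : r ≠ 0) (h1 : |r| < 1) (ω : ℝ) :
    ∫ t : ℝ, (betaDensity r t : ℂ) * Complex.exp (-(Complex.I * t * ω)) = sinhKernel r ω := by
  -- Both sides are even in `r`.
  wlog h0 : 0 < r generalizing r
  · have := this (neg_ne_zero.2 hr) (by rwa [abs_neg])
      (neg_pos.2 (lt_of_le_of_ne (not_lt.1 h0) hr))
    simpa only [betaDensity_neg_left, sinhKernel_neg_left] using this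
  have hpi := Real.pi_pos
  have h1' : r < 1 := by rwa [abs_of_pos h0] at h1
  -- The integral of a non-integrable function is 0 by convention, so a nonzero value proves
  -- integrability.
  have hK : Integrable fun ω : ℝ => (sinhKernel r ω : ℂ) := by
    refine Integrable.of_integral_ne_zero ?_
    have h := integral_sinhKernel_mul_cexp h0 h1' 0
    simp only [Complex.ofReal_zero, mul_zero, neg_zero, Complex.exp_zero, mul_one] at h
    rw [h]
    have hb : 0 < betaDensity r 0 := by
      refine div_pos (Real.sin_pos_of_pos_of_lt_pi (by positivity) ?_)
        (mul_pos (by positivity) (cosh_add_cos_pos h1 0))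
      nlinarith
    exact_mod_cast (by positivity : 2 * Real.pi * betaDensity r 0 ≠ 0)
  -- The factor `2π` matches the `e^{-2πivt}` normalization of the Fourier transform.
  let f : ℝ → ℂ := fun v => (sinhKernel r (2 * Real.pi * v) : ℂ)
  have hfc : Continuous f :=
    Complex.continuous_ofReal.comp ((continuous_sinhKernel hr).comp (by fun_prop))
  have hfi : Integrable f := hK.comp_mul_left' (by positivity)
  have hfour : FourierTransform.fourier f = fun t => (betaDensity r t : ℂ) := by
    ext t
    rw [Real.fourier_real_eq_integral_exp_smul]
    have h := Measure.integral_comp_mul_left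
      (fun ω : ℝ => (sinhKernel r ω : ℂ) * Complex.exp (-(Complex.I * ω * t))) (2 * Real.pi)
    rw [integral_sinhKernel_mul_cexp h0 h1' t] at h
    have e : (∫ v : ℝ, Complex.exp (↑(-2 * Real.pi * v * t) * Complex.I) • f v) =
        ∫ x : ℝ, (sinhKernel r (2 * Real.pi * x) : ℂ) *
          Complex.exp (-(Complex.I * ((2 * Real.pi * x : ℝ) : ℂ) * t)) := by
      refine integral_congr_ae (Filter.Eventually.of_forall fun x => ?_)
      simp only [smul_eq_mul, f]
      rw [mul_comm]
      push_cast
      ring_nf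
    rw [e, h, abs_of_pos (by positivity), Complex.real_smul, ← Complex.ofReal_mul]
    congr 1
    field_simp
  have hinv := congrFun (hfc.fourierInv_fourier_eq hfi
    (by rw [hfour]; exact (integrable_betaDensity h1).ofReal)) (-ω / (2 * Real.pi))
  rw [hfour, Real.fourierInv_eq_fourier_neg, Real.fourier_real_eq_integral_exp_smul] at hinv
  have hval : f (-ω / (2 * Real.pi)) = sinhKernel r ω := by
    simp only [f]
    rw [mul_div_cancel₀ _ (by positivity), sinhKernel_neg]
  rw [← hval, ← hinv]
  refine integral_congr_ae (Filter.Eventually.of_forall fun t => ?_)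
  simp only [smul_eq_mul]
  rw [mul_comm]
  congr 2
  push_cast
  have : (Real.pi : ℂ) ≠ 0 := by exact_mod_cast hpi.ne'
  field_simp

theorem integral_betaDensity {r : ℝ} (hr : r ≠ 0) (h1 : |r| < 1) :
    ∫ t : ℝ, betaDensity r t = 1 := by
  have h := integral_betaDensity_mul_cexp hr h1 0
  simp only [Complex.ofReal_zero, mul_zero, neg_zero, Complex.exp_zero, mul_one,
    sinhKernel_zero] at h
  rw [integral_complex_ofReal] at h
  exact_mod_cast h

theorem integrable_tentDensity : Integrable fun t => (tentDensity t : ℂ) := by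
  refine Integrable.of_integral_ne_zero ?_
  have h := integral_tentDensity_mul_cexp 0
  simp only [Complex.ofReal_zero, mul_zero, neg_zero, Complex.exp_zero, mul_one,
    tanhKernel_zero] at h
  rw [h]
  simp

/-! ### Schur multipliers and twirls in an eigenbasis -/

section Spectral

variable {n : Type*} [Fintype n] [DecidableEq n]

/-- The matrix `U diag(d) Uᴴ`. -/
def conjDiag (U : Matrix n n ℂ) (d : n → ℂ) : Matrix n n ℂ := U * Matrix.diagonal d * Uᴴ

/-- The Schur multiplier with symbol `K`, taken in the basis of the columns of `U`. -/
def schurMul (U K Y : Matrix n n ℂ) : Matrix n n ℂ := U * (K ⊙ (Uᴴ * Y * U)) * Uᴴ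

/-- The columns of `U` form an orthonormal eigenbasis of `A`, with eigenvalues `e`. -/
structure IsSpectral (A U : Matrix n n ℂ) (e : n → ℝ) : Prop where
  star_mul : Uᴴ * U = 1
  mul_star : U * Uᴴ = 1
  cfc_eq : ∀ f : ℝ → ℝ, cfc f A = conjDiag U fun i => (f (e i) : ℂ)
  eq_conjDiag : A = conjDiag U fun i => (e i : ℂ)
  mem_spectrum : ∀ i, e i ∈ spectrum ℝ A

theorem exists_isSpectral {A : Matrix n n ℂ} (hA : A.IsHermitian) : ∃ U e, IsSpectral A U e := by
  refine ⟨hA.eigenvectorUnitary, hA.eigenvalues, ?_, ?_, fun f => ?_, ?_, fun i => ?_⟩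
  · exact Unitary.coe_star_mul_self _
  · exact Unitary.coe_mul_star_self _
  · rw [hA.cfc_eq]
    rfl
  · exact hA.spectral_theorem
  · exact hA.eigenvalues_mem_spectrum_real i

variable {A U K L Y Z : Matrix n n ℂ} {d d' : n → ℂ} {e : n → ℝ}

theorem conjDiag_mul (hU : Uᴴ * U = 1) :
    conjDiag U d * conjDiag U d' = conjDiag U fun i => d i * d' i := by
  simp only [conjDiag]
  rw [show U * Matrix.diagonal d * Uᴴ * (U * Matrix.diagonal d' * Uᴴ) =
    U * Matrix.diagonal d * (Uᴴ * U) * Matrix.diagonal d' * Uᴴ by simp only [Matrix.mul_assoc],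
    hU, Matrix.mul_one, Matrix.mul_assoc U, Matrix.diagonal_mul_diagonal]

theorem conjDiag_one (hU : U * Uᴴ = 1) : conjDiag U (fun _ => 1) = 1 := by
  rw [conjDiag, Matrix.diagonal_one, Matrix.mul_one, hU]

theorem star_mul_conjDiag_mul (hU : Uᴴ * U = 1) : Uᴴ * conjDiag U d * U = Matrix.diagonal d := by
  rw [conjDiag, show Uᴴ * (U * Matrix.diagonal d * Uᴴ) * U =
    Uᴴ * U * Matrix.diagonal d * (Uᴴ * U) by simp only [Matrix.mul_assoc], hU, Matrix.one_mul,
    Matrix.mul_one]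

theorem exp_conjDiag (hU : U * Uᴴ = 1) :
    NormedSpace.exp (conjDiag U d) = conjDiag U fun i => Complex.exp (d i) := by
  have hinv : U⁻¹ = Uᴴ := Matrix.inv_eq_right_inv hU
  have hunit : IsUnit U := ⟨⟨U, Uᴴ, hU, mul_eq_one_comm.1 hU⟩, rfl⟩
  rw [conjDiag, ← hinv, Matrix.exp_conj _ _ hunit, Matrix.exp_diagonal, hinv, Pi.exp_def,
    conjDiag, Complex.exp_eq_exp_ℂ]

theorem smul_conjDiag (z : ℂ) : z • conjDiag U d = conjDiag U fun i => z * d i := by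
  rw [conjDiag, conjDiag, ← Matrix.smul_mul, ← Matrix.mul_smul, ← Matrix.diagonal_smul]
  rfl

theorem trace_conjDiag (hU : Uᴴ * U = 1) : (conjDiag U d).trace = ∑ i, d i := by
  rw [conjDiag, Matrix.trace_mul_comm, ← Matrix.mul_assoc, hU, Matrix.one_mul,
    Matrix.trace_diagonal]

theorem posDef_conjDiag (hU : U * Uᴴ = 1) (hd : ∀ i, 0 < d i) : (conjDiag U d).PosDef := by
  refine (Matrix.PosDef.diagonal hd).mul_mul_conjTranspose_same fun v w h => ?_
  have := congrArg (fun x => x ᵥ* Uᴴ) h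
  simpa [Matrix.vecMul_vecMul, hU] using this

namespace IsSpectral

theorem exp_smul (h : IsSpectral A U e) (z : ℂ) :
    NormedSpace.exp (z • A) = conjDiag U fun i => Complex.exp (z * e i) := by
  conv_lhs => rw [h.eq_conjDiag]
  rw [smul_conjDiag, exp_conjDiag h.mul_star]

theorem exp_neg (h : IsSpectral A U e) :
    NormedSpace.exp (-A) = conjDiag U fun i => (Real.exp (-e i) : ℂ) := by
  rw [← neg_one_smul ℂ, h.exp_smul]
  simp

theorem cpow_eq (h : IsSpectral A U e) (z : ℂ) :
    cpow A z = conjDiag U fun i => Complex.exp (z * Real.log (e i)) := by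
  rw [cpow, h.cfc_eq, smul_conjDiag, exp_conjDiag h.mul_star]

theorem rpow_eq (h : IsSpectral A U e) (s : ℝ) :
    rpow A s = conjDiag U fun i => ((e i ^ s : ℝ) : ℂ) :=
  h.cfc_eq _

theorem pos (h : IsSpectral A U e) (hA : A.PosDef) (i : n) : 0 < e i := by
  have hinj : Function.Injective U.mulVec := fun v w hvw => by
    have := congrArg (fun x => Uᴴ *ᵥ x) hvw
    simpa [Matrix.mulVec_mulVec, h.star_mul] using this
  have hp := (hA.conjTranspose_mul_mul_same hinj).diag_pos (i := i)
  rw [h.eq_conjDiag, star_mul_conjDiag_mul h.star_mul, Matrix.diagonal_apply_eq] at hp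
  exact_mod_cast hp

end IsSpectral

theorem schurMul_add : schurMul U K (Y + Z) = schurMul U K Y + schurMul U K Z := by
  simp only [schurMul, Matrix.mul_add, Matrix.add_mul, Matrix.hadamard_add]

theorem schurMul_smul (c : ℂ) : schurMul U K (c • Y) = c • schurMul U K Y := by
  simp only [schurMul, Matrix.mul_smul, Matrix.smul_mul, Matrix.hadamard_smul]

theorem smul_schurMul (c : ℂ) : schurMul U (c • K) Y = c • schurMul U K Y := by
  simp only [schurMul, Matrix.mul_smul, Matrix.smul_mul, Matrix.smul_hadamard]

theorem schurMul_add_left : schurMul U (K + L) Y = schurMul U K Y + schurMul U L Y := by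
  simp only [schurMul, Matrix.mul_add, Matrix.add_mul, Matrix.add_hadamard]

theorem conjTranspose_schurMul : (schurMul U K Y)ᴴ = schurMul U Kᴴ Yᴴ := by
  have hadamard : ∀ M N : Matrix n n ℂ, (M ⊙ N)ᴴ = Mᴴ ⊙ Nᴴ := fun M N => by
    ext i j
    simp
  simp only [schurMul, Matrix.conjTranspose_mul, Matrix.conjTranspose_conjTranspose, hadamard,
    Matrix.mul_assoc]

/-- The trace pairing transposes the symbol; for the even kernels used here the multiplier is
therefore self-adjoint, and can be moved between state and observable. -/
theorem trace_mul_schurMul :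
    (Y * schurMul U K Z).trace = (schurMul U Kᵀ Y * Z).trace := by
  have h1 : (Y * schurMul U K Z).trace = ((Uᴴ * Y * U) * (K ⊙ (Uᴴ * Z * U))).trace := by
    rw [schurMul, ← Matrix.mul_assoc, Matrix.trace_mul_comm]
    simp only [Matrix.mul_assoc]
  have h2 : (schurMul U Kᵀ Y * Z).trace = ((Kᵀ ⊙ (Uᴴ * Y * U)) * (Uᴴ * Z * U)).trace := by
    rw [schurMul, Matrix.mul_assoc, Matrix.mul_assoc, Matrix.trace_mul_comm]
    simp only [Matrix.mul_assoc]
  rw [h1, h2]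
  generalize Uᴴ * Y * U = M
  generalize Uᴴ * Z * U = N
  simp only [Matrix.trace, Matrix.diag_apply, Matrix.mul_apply, Matrix.hadamard_apply,
    Matrix.transpose_apply]
  exact Finset.sum_congr rfl fun i _ => Finset.sum_congr rfl fun j _ => by ring

theorem schurMul_mul_conjDiag (hU : Uᴴ * U = 1) :
    schurMul U K Y * conjDiag U d = schurMul U (Matrix.of fun i j => K i j * d j) Y := by
  rw [schurMul, conjDiag, schurMul,
    show U * (K ⊙ (Uᴴ * Y * U)) * Uᴴ * (U * Matrix.diagonal d * Uᴴ) =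
      U * ((K ⊙ (Uᴴ * Y * U)) * (Uᴴ * U) * Matrix.diagonal d) * Uᴴ by
      simp only [Matrix.mul_assoc], hU, Matrix.mul_one]
  congr 2
  ext i j
  simp only [Matrix.mul_diagonal, Matrix.hadamard_apply, Matrix.of_apply]
  ring

theorem conjDiag_mul_schurMul (hU : Uᴴ * U = 1) :
    conjDiag U d * schurMul U K Y = schurMul U (Matrix.of fun i j => d i * K i j) Y := by
  rw [schurMul, conjDiag, schurMul,
    show (U * Matrix.diagonal d * Uᴴ) * (U * (K ⊙ (Uᴴ * Y * U)) * Uᴴ) =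
      U * (Matrix.diagonal d * ((Uᴴ * U) * (K ⊙ (Uᴴ * Y * U)))) * Uᴴ by
      simp only [Matrix.mul_assoc], hU, Matrix.one_mul]
  congr 2
  ext i j
  simp only [Matrix.diagonal_mul, Matrix.hadamard_apply, Matrix.of_apply]
  ring

theorem schurMul_conjDiag (hU : Uᴴ * U = 1) :
    schurMul U K (conjDiag U d) = conjDiag U fun i => K i i * d i := by
  rw [schurMul, star_mul_conjDiag_mul hU, conjDiag]
  congr 2
  ext i j
  by_cases hij : i = j
  · subst hij; simp
  · simp [hij]

theorem schurMul_one (hU : U * Uᴴ = 1) (hK : ∀ i j, K i j = 1) : schurMul U K Y = Y := by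
  have : K ⊙ (Uᴴ * Y * U) = Uᴴ * Y * U := by
    ext i j
    simp [hK]
  rw [schurMul, this, show U * (Uᴴ * Y * U) * Uᴴ = U * Uᴴ * Y * (U * Uᴴ) by
    simp only [Matrix.mul_assoc], hU, Matrix.one_mul, Matrix.mul_one]

theorem conjDiag_mul_mul_conjDiag :
    conjDiag U d * Y * conjDiag U d' = schurMul U (Matrix.of fun i j => d i * d' j) Y := by
  rw [schurMul, conjDiag, conjDiag,
    show (U * Matrix.diagonal d * Uᴴ) * Y * (U * Matrix.diagonal d' * Uᴴ) =
      U * (Matrix.diagonal d * (Uᴴ * Y * U) * Matrix.diagonal d') * Uᴴ by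
      simp only [Matrix.mul_assoc]]
  congr 2
  ext i j
  simp only [Matrix.mul_diagonal, Matrix.diagonal_mul, Matrix.hadamard_apply, Matrix.of_apply]
  ring

theorem schurMul_apply (a b : n) :
    schurMul U K Y a b = ∑ j, ∑ i, K i j * (U a i * (Uᴴ * Y * U) i j * Uᴴ j b) := by
  rw [schurMul, Matrix.mul_apply]
  refine Finset.sum_congr rfl fun j _ => ?_
  rw [Matrix.mul_apply, Finset.sum_mul]
  refine Finset.sum_congr rfl fun i _ => ?_
  rw [Matrix.hadamard_apply]
  ring

/-- Averaging the conjugations by `U diag(exp(-i t e)) Uᴴ` over a density multiplies the entries in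
the basis of the columns of `U` by the Fourier transform of the density. -/
theorem integral_twirl (p : ℝ → ℝ) (φ : ℝ → ℝ) (hp : Integrable fun t => (p t : ℂ))
    (hφ : ∀ ω : ℝ, ∫ t : ℝ, (p t : ℂ) * Complex.exp (-(Complex.I * t * ω)) = φ ω)
    (U Y : Matrix n n ℂ) (e : n → ℝ) :
    (Matrix.of fun a b => ∫ t : ℝ, (p t : ℂ) *
      ((conjDiag U fun i => Complex.exp (-(Complex.I * t * e i))) * Y *
        conjDiag U fun i => Complex.exp (Complex.I * t * e i)) a b) =
      schurMul U (Matrix.of fun i j => (φ (e i - e j) : ℂ)) Y := by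
  have hint : ∀ ω : ℝ, Integrable fun t : ℝ =>
      (p t : ℂ) * Complex.exp (-(Complex.I * t * ω)) := fun ω => by
    refine hp.mul_bdd (c := 1) (by fun_prop) (Filter.Eventually.of_forall fun t => ?_)
    exact (norm_cexp_neg_I_mul t ω).le
  ext a b
  rw [Matrix.of_apply, schurMul_apply]
  have hpt : ∀ t : ℝ, (p t : ℂ) *
      ((conjDiag U fun i => Complex.exp (-(Complex.I * t * e i))) * Y *
        conjDiag U fun i => Complex.exp (Complex.I * t * e i)) a b =
      ∑ j, ∑ i, (p t : ℂ) * Complex.exp (-(Complex.I * t * ((e i - e j : ℝ) : ℂ))) *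
        (U a i * (Uᴴ * Y * U) i j * Uᴴ j b) := fun t => by
    rw [conjDiag_mul_mul_conjDiag, schurMul_apply, Finset.mul_sum]
    refine Finset.sum_congr rfl fun j _ => ?_
    rw [Finset.mul_sum]
    refine Finset.sum_congr rfl fun i _ => ?_
    rw [Matrix.of_apply, ← Complex.exp_add, ← mul_assoc]
    congr 3
    push_cast
    ring
  simp_rw [hpt]
  rw [integral_finsetSum _ fun j _ => integrable_finsetSum _ fun i _ => (hint _).mul_const _]
  refine Finset.sum_congr rfl fun j _ => ?_
  rw [integral_finsetSum _ fun i _ => (hint _).mul_const _]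
  refine Finset.sum_congr rfl fun i _ => ?_
  rw [integral_mul_const, hφ, Matrix.of_apply]

/-- The symbol of the tent twirl. -/
def tentSymbol (e : n → ℝ) : Matrix n n ℂ := Matrix.of fun i j => (tanhKernel (e i - e j) : ℂ)

/-- The symbol of the modular twirl. -/
def modularSymbol (r : ℝ) (e : n → ℝ) : Matrix n n ℂ :=
  Matrix.of fun i j => (sinhKernel r (Real.log (e i) / 2 - Real.log (e j) / 2) : ℂ)

theorem IsSpectral.tentTwirl_eq (h : IsSpectral A U e) (Y : Matrix n n ℂ) :
    tentTwirl A Y = schurMul U (tentSymbol e) Y := by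
  rw [tentSymbol, ← integral_twirl tentDensity tanhKernel integrable_tentDensity
    integral_tentDensity_mul_cexp]
  ext a b
  simp only [tentTwirl, h.exp_smul, neg_mul]

theorem IsSpectral.modularTwirl_eq (h : IsSpectral A U e) {q : ℝ}
    (hq : q ∈ Set.Ioo (0 : ℝ) 1 ∪ Set.Ioc (1 : ℝ) 2) (X : Matrix n n ℂ) :
    modularTwirl q A X = schurMul U (modularSymbol (1 - q) e) X := by
  by_cases hq2 : q = 2
  · subst hq2
    rw [modularTwirl, if_pos rfl, schurMul_one h.mul_star]
    intro i j
    -- At `r = -1` the kernel is identically 1, so the point-mass convention obeys the same formula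
    -- as the other orders.
    rw [modularSymbol, Matrix.of_apply, show (1 - 2 : ℝ) = -1 by norm_num, sinhKernel_neg_left,
      sinhKernel]
    split_ifs with h0
    · simp
    · rw [one_mul, one_mul, div_self (by simpa using h0)]
      simp
  · have hr : 1 - q ≠ 0 ∧ |1 - q| < 1 := by
      rw [abs_lt]
      rcases hq with ⟨h1, h2⟩ | ⟨h1, h2⟩
      · exact ⟨by linarith, by linarith, by linarith⟩
      · have := lt_of_le_of_ne h2 hq2
        exact ⟨by linarith, by linarith, by linarith⟩
    rw [modularSymbol, ← integral_twirl (betaDensity (1 - q)) (sinhKernel (1 - q))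
      (integrable_betaDensity hr.2).ofReal (integral_betaDensity_mul_cexp hr.1 hr.2) U X
      (fun i => Real.log (e i) / 2)]
    ext a b
    simp only [modularTwirl, if_neg hq2, h.cpow_eq]
    refine integral_congr_ae (Filter.Eventually.of_forall fun t => ?_)
    push_cast
    ring_nf

theorem tentSymbol_transpose : (tentSymbol e)ᵀ = tentSymbol e := by
  ext i j
  simp only [tentSymbol, Matrix.transpose_apply, Matrix.of_apply]
  rw [← neg_sub, tanhKernel_neg]

theorem tentSymbol_conjTranspose : (tentSymbol e)ᴴ = tentSymbol e := by
  ext i j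
  simp only [tentSymbol, Matrix.conjTranspose_apply, Matrix.of_apply, RCLike.star_def,
    Complex.conj_ofReal]
  rw [← neg_sub, tanhKernel_neg]

theorem modularSymbol_transpose {r : ℝ} : (modularSymbol r e)ᵀ = modularSymbol r e := by
  ext i j
  simp only [modularSymbol, Matrix.transpose_apply, Matrix.of_apply]
  rw [← neg_sub, sinhKernel_neg]

theorem modularSymbol_conjTranspose {r : ℝ} : (modularSymbol r e)ᴴ = modularSymbol r e := by
  ext i j
  simp only [modularSymbol, Matrix.conjTranspose_apply, Matrix.of_apply, RCLike.star_def,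
    Complex.conj_ofReal]
  rw [← neg_sub, sinhKernel_neg]

theorem tentSymbol_diag (i : n) : tentSymbol e i i = 1 := by
  simp [tentSymbol, tanhKernel_zero]

theorem modularSymbol_diag {r : ℝ} (i : n) : modularSymbol r e i i = 1 := by
  simp [modularSymbol, sinhKernel_zero]

/-! ### Differentiation of the functional calculus -/

open scoped Matrix.Norms.L2Operator in
-- Upper hemicontinuity of the spectrum. It allows functions that are regular only on an open set,
-- such as powers on the positive half-line.
theorem exists_isCompact_eventually_spectrum_subset (B : Matrix n n ℂ) {s : Set ℝ} (hs : IsOpen s)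
    (hB : spectrum ℝ B ⊆ s) :
    ∃ S, IsCompact S ∧ S ⊆ s ∧ ∀ᶠ C in nhds B, spectrum ℝ C ⊆ S := by
  obtain ⟨S, ⟨hS₁, hS₂⟩, hS₃⟩ := (spectrum.isCompact (𝕜 := ℝ) B).nhdsSet_basis_isCompact.mem_iff.mp
    (hs.mem_nhdsSet.2 hB)
  exact ⟨S, hS₂, hS₃, ((upperHemicontinuous_spectrum ℝ _).upperHemicontinuousAt B _ hS₁).mono
    fun _ => subset_of_mem_nhdsSet⟩

open scoped Matrix.Norms.L2Operator in
theorem continuousAt_cfc_of_isOpen {f : ℝ → ℝ} {B : ℝ → Matrix n n ℂ} {s : Set ℝ} {x : ℝ}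
    (hs : IsOpen s) (hf : ContinuousOn f s) (hB : ContinuousAt B x)
    (hBs : spectrum ℝ (B x) ⊆ s) (hBh : ∀ y, (B y).IsHermitian) :
    ContinuousAt (fun y => cfc f (B y)) x := by
  obtain ⟨S, hS, hSs, hev⟩ := exists_isCompact_eventually_spectrum_subset (B x) hs hBs
  exact ContinuousAt.cfc hS f hB (hB.eventually hev) (.of_forall fun y => hBh y) (hf.mono hSs)

theorem cfc_dslope_mul_sub {B : Matrix n n ℂ} (hB : B.IsHermitian) (f : ℝ → ℝ) (μ : ℝ) :
    cfc (dslope f μ) B * (B - (μ : ℂ) • 1) = cfc f B - (f μ : ℂ) • 1 := by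
  obtain ⟨W, g, h⟩ := exists_isSpectral hB
  have hone : ∀ c : ℂ, c • (1 : Matrix n n ℂ) = conjDiag W fun _ => c := fun c => by
    rw [← conjDiag_one h.mul_star, smul_conjDiag]
    simp
  have hsub : ∀ d d' : n → ℂ, conjDiag W d - conjDiag W d' = conjDiag W fun i => d i - d' i :=
    fun d d' => by
      simp only [conjDiag]
      rw [← Matrix.sub_mul, ← Matrix.mul_sub, Matrix.diagonal_sub]
  conv_lhs => rw [h.eq_conjDiag]
  rw [← h.eq_conjDiag, h.cfc_eq, h.cfc_eq, hone, hone, hsub]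
  conv_lhs => rw [h.eq_conjDiag, hsub]
  rw [conjDiag_mul h.star_mul]
  congr 1
  ext i
  have := sub_smul_dslope f μ (g i)
  rw [smul_eq_mul] at this
  rw [← Complex.ofReal_sub, ← Complex.ofReal_sub, ← this]
  push_cast
  ring

/-- The difference of two values of the functional calculus in terms of divided differences. -/
theorem IsSpectral.cfc_sub_cfc (h : IsSpectral A U e) {B : Matrix n n ℂ} (hB : B.IsHermitian)
    (f : ℝ → ℝ) :
    cfc f B - cfc f A =
      ∑ j, cfc (dslope f (e j)) B * (B - A) * conjDiag U (Pi.single j 1) := by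
  have hone : ∑ j, conjDiag U (Pi.single j 1) = 1 := by
    simp only [conjDiag]
    rw [← Finset.sum_mul, ← Finset.mul_sum]
    have : ∑ j : n, Matrix.diagonal (Pi.single j (1 : ℂ)) = (1 : Matrix n n ℂ) := by
      ext a b
      rw [Matrix.sum_apply]
      by_cases hab : a = b
      · subst hab; simp [Pi.single_apply]
      · simp [hab]
    rw [this, Matrix.mul_one, h.mul_star]
  have hproj : ∀ (d : n → ℂ) (j : n), conjDiag U d * conjDiag U (Pi.single j 1) =
      d j • conjDiag U (Pi.single j 1) := fun d j => by
    rw [conjDiag_mul h.star_mul, smul_conjDiag]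
    congr 1
    ext i
    by_cases hij : i = j
    · subst hij; simp
    · simp [hij]
  -- On the `j`-th eigenvector of `A`, both `A` and `cfc f A` act as scalars, so a divided
  -- difference based at `e j` and evaluated at `B` suffices; no eigenbasis of `B` enters the
  -- identity.
  have hterm : ∀ j, cfc (dslope f (e j)) B * (B - A) * conjDiag U (Pi.single j 1) =
      (cfc f B - cfc f A) * conjDiag U (Pi.single j 1) := fun j => by
    have hA : A * conjDiag U (Pi.single j 1) = (e j : ℂ) • conjDiag U (Pi.single j 1) := by
      conv_lhs => rw [h.eq_conjDiag]
      exact hproj _ j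
    have hfA : cfc f A * conjDiag U (Pi.single j 1) =
        (f (e j) : ℂ) • conjDiag U (Pi.single j 1) := by
      rw [h.cfc_eq]
      exact hproj _ j
    have h1 : (B - A) * conjDiag U (Pi.single j 1) =
        (B - (e j : ℂ) • 1) * conjDiag U (Pi.single j 1) := by
      rw [Matrix.sub_mul, Matrix.sub_mul, hA, Matrix.smul_mul, Matrix.one_mul]
    rw [Matrix.mul_assoc, h1, ← Matrix.mul_assoc, cfc_dslope_mul_sub hB, Matrix.sub_mul,
      Matrix.sub_mul, hfA, Matrix.smul_mul, Matrix.one_mul]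
  rw [Finset.sum_congr rfl fun j _ => hterm j, ← Finset.mul_sum, hone, Matrix.mul_one]

/-- The matrix of divided differences of `f` at the points `e`. -/
def dividedDiff (f : ℝ → ℝ) (e : n → ℝ) : Matrix n n ℂ :=
  Matrix.of fun i j => ((dslope f (e j) (e i) : ℝ) : ℂ)

open scoped Matrix.Norms.L2Operator in
/-- The Daleckii--Krein formula. -/
theorem hasDerivAt_cfc {f : ℝ → ℝ} {B : ℝ → Matrix n n ℂ} {B' : Matrix n n ℂ} {s : Set ℝ} {x : ℝ}
    (hs : IsOpen s) (hf : DifferentiableOn ℝ f s) (hB : HasDerivAt B B' x)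
    (hBs : spectrum ℝ (B x) ⊆ s) (hBh : ∀ y, (B y).IsHermitian) (h : IsSpectral (B x) U e) :
    HasDerivAt (fun y => cfc f (B y)) (schurMul U (dividedDiff f e) B') x := by
  rw [hasDerivAt_iff_tendsto_slope]
  have hes : ∀ j, e j ∈ s := fun j => hBs (h.mem_spectrum j)
  have hcont : ∀ j, ContinuousAt (fun y => cfc (dslope f (e j)) (B y)) x := fun j => by
    refine continuousAt_cfc_of_isOpen hs ?_ hB.continuousAt hBs hBh
    rw [continuousOn_dslope (hs.mem_nhds (hes j))]
    exact ⟨hf.continuousOn, hf.differentiableAt (hs.mem_nhds (hes j))⟩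
  have hval : schurMul U (dividedDiff f e) B' =
      ∑ j, cfc (dslope f (e j)) (B x) * B' * conjDiag U (Pi.single j 1) := by
    simp only [h.cfc_eq, conjDiag_mul_mul_conjDiag]
    ext a b
    rw [Matrix.sum_apply]
    simp only [schurMul_apply]
    refine Eq.trans ?_ Finset.sum_comm
    refine Finset.sum_congr rfl fun j _ => ?_
    refine Eq.trans ?_ Finset.sum_comm
    refine Finset.sum_congr rfl fun i _ => ?_
    rw [← Finset.sum_mul]
    simp [dividedDiff, Pi.single_apply]
  rw [hval]
  -- The difference formula is exact for finite increments, so the limit needs only continuity of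
  -- the divided differences along the curve.
  have hslope : slope (fun y => cfc f (B y)) x =
      fun y => ∑ j, cfc (dslope f (e j)) (B y) * slope B x y * conjDiag U (Pi.single j 1) := by
    ext1 y
    rw [slope_def_module, h.cfc_sub_cfc (hBh y), Finset.smul_sum]
    refine Finset.sum_congr rfl fun j _ => ?_
    rw [slope_def_module, Matrix.mul_smul, Matrix.smul_mul]
  rw [hslope]
  refine tendsto_finsetSum _ fun j _ => ?_
  exact (((hcont j).tendsto.mono_left nhdsWithin_le_nhds).mul
    (hasDerivAt_iff_tendsto_slope.1 hB)).mul tendsto_const_nhds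

end Spectral

/-! ### Divided differences of `e^{-x}` and `x^{1-q}` -/

theorem dslope_exp_neg (a b : ℝ) :
    dslope (fun x => Real.exp (-x)) b a =
      -(1 / 2) * (Real.exp (-a) + Real.exp (-b)) * tanhKernel (a - b) := by
  by_cases hab : a = b
  · subst hab
    rw [dslope_same, sub_self, tanhKernel_zero]
    have : HasDerivAt (fun x => Real.exp (-x)) (Real.exp (-a) * -1) a := (hasDerivAt_neg a).exp
    rw [this.deriv]
    ring
  · have hsub : a - b ≠ 0 := sub_ne_zero.2 hab
    rw [dslope_of_ne _ hab, slope_def_field, tanhKernel, if_neg hsub, Real.tanh_eq_sinh_div_cosh,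
      Real.sinh_eq, Real.cosh_eq]
    have e1 : Real.exp (-a) = Real.exp (-(a / 2)) ^ 2 := by rw [← Real.exp_nat_mul]; ring_nf
    have e2 : Real.exp (-b) = Real.exp (-(b / 2)) ^ 2 := by rw [← Real.exp_nat_mul]; ring_nf
    have e3 : Real.exp ((a - b) / 2) = Real.exp (-(b / 2)) / Real.exp (-(a / 2)) := by
      rw [← Real.exp_sub]; ring_nf
    have e4 : Real.exp (-((a - b) / 2)) = Real.exp (-(a / 2)) / Real.exp (-(b / 2)) := by
      rw [← Real.exp_sub]; ring_nf
    rw [e1, e2, e3, e4]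
    have h1 := Real.exp_pos (-(a / 2))
    have h2 := Real.exp_pos (-(b / 2))
    generalize Real.exp (-(a / 2)) = p at h1
    generalize Real.exp (-(b / 2)) = r at h2
    have h3 : r ^ 2 + p ^ 2 ≠ 0 := by positivity
    field_simp
    ring

theorem dslope_rpow {a b : ℝ} (ha : 0 < a) (hb : 0 < b) {q : ℝ} (hq : q ≠ 1) :
    dslope (fun x => x ^ (1 - q)) b a =
      (1 - q) * (a ^ (-q / 2) * sinhKernel (1 - q) (Real.log a / 2 - Real.log b / 2) *
        b ^ (-q / 2)) := by
  have hs : 1 - q ≠ 0 := sub_ne_zero.2 hq.symm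
  by_cases hab : a = b
  · subst hab
    rw [dslope_same, sub_self, sinhKernel_zero, Real.deriv_rpow_const, mul_one,
      ← Real.rpow_add ha]
    ring_nf
  · have hlog : Real.log a / 2 - Real.log b / 2 ≠ 0 := fun h =>
      hab (Real.log_injOn_pos ha hb (by linarith))
    rw [dslope_of_ne _ hab, slope_def_field, sinhKernel, if_neg hlog]
    obtain ⟨x, rfl⟩ : ∃ x, a = Real.exp (2 * x) :=
      ⟨Real.log a / 2, by rw [mul_div_cancel₀ _ two_ne_zero, Real.exp_log ha]⟩
    obtain ⟨y, rfl⟩ : ∃ y, b = Real.exp (2 * y) :=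
      ⟨Real.log b / 2, by rw [mul_div_cancel₀ _ two_ne_zero, Real.exp_log hb]⟩
    simp only [Real.log_exp, ← Real.exp_mul, mul_div_cancel_left₀ _ (two_ne_zero' ℝ)] at hlog ⊢
    -- Used with `c = 1 - q` for the numerator and `c = 1` for the denominator; the ratio of the
    -- sinh factors is the kernel.
    have key : ∀ c : ℝ, Real.exp (2 * x * c) - Real.exp (2 * y * c) =
        2 * Real.exp (c * (x + y)) * Real.sinh (c * (x - y)) := fun c => by
      have h1 : Real.exp (2 * x * c) = Real.exp (c * (x + y)) * Real.exp (c * (x - y)) := by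
        rw [← Real.exp_add]; ring_nf
      have h2 : Real.exp (2 * y * c) = Real.exp (c * (x + y)) * Real.exp (-(c * (x - y))) := by
        rw [← Real.exp_add]; ring_nf
      rw [Real.sinh_eq, h1, h2]
      ring
    have k1 := key 1
    simp only [mul_one, one_mul] at k1
    rw [key, k1]
    have hsinh : Real.sinh (x - y) ≠ 0 := by simpa using hlog
    have e1 : Real.exp ((1 - q) * (x + y)) =
        Real.exp (2 * x * (-q / 2)) * Real.exp (2 * y * (-q / 2)) * Real.exp (x + y) := by
      rw [← Real.exp_add, ← Real.exp_add]; ring_nf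
    rw [e1]
    have := (Real.exp_pos (x + y)).ne'
    field_simp

open scoped Matrix.Norms.L2Operator

/-! ### Derivatives of Gibbs states and of the relative entropy -/

section

variable {n : Type*} [Fintype n] [DecidableEq n] {A U : Matrix n n ℂ} {e : n → ℝ}

theorem hasDerivAt_linearMap_comp {F : Type*} [NormedAddCommGroup F] [NormedSpace ℂ F]
    {B : ℝ → Matrix n n ℂ} {B' : Matrix n n ℂ} {x : ℝ} (hB : HasDerivAt B B' x)
    (l : Matrix n n ℂ →ₗ[ℂ] F) : HasDerivAt (fun y => l (B y)) (l B') x :=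
  ((LinearMap.toContinuousLinearMap l).restrictScalars ℝ).hasFDerivAt.comp_hasDerivAt x hB

theorem hasDerivAt_trace_mul {B : ℝ → Matrix n n ℂ} {B' : Matrix n n ℂ} {x : ℝ}
    (hB : HasDerivAt B B' x) (M : Matrix n n ℂ) :
    HasDerivAt (fun y => (M * B y).trace) (M * B').trace x :=
  hasDerivAt_linearMap_comp hB (Matrix.traceLinearMap n ℂ ℂ ∘ₗ LinearMap.mulLeft ℂ M)

theorem IsSpectral.dividedDiff_exp_neg (h : IsSpectral A U e) (Y : Matrix n n ℂ) :
    schurMul U (dividedDiff (fun x => Real.exp (-x)) e) Y =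
      (-(1 / 2) : ℂ) • anticomm (tentTwirl A Y) (NormedSpace.exp (-A)) := by
  rw [h.tentTwirl_eq, h.exp_neg, anticomm, schurMul_mul_conjDiag h.star_mul,
    conjDiag_mul_schurMul h.star_mul, ← schurMul_add_left, ← smul_schurMul]
  congr 1
  ext i j
  simp only [dividedDiff, tentSymbol, Matrix.of_apply, Matrix.smul_apply, Matrix.add_apply,
    dslope_exp_neg, smul_eq_mul]
  push_cast
  ring

theorem IsSpectral.trace_tentTwirl_mul (h : IsSpectral A U e) (Y Z : Matrix n n ℂ) :
    (tentTwirl A Y * Z).trace = (Y * tentTwirl A Z).trace := by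
  rw [h.tentTwirl_eq, h.tentTwirl_eq, trace_mul_schurMul, tentSymbol_transpose]

theorem IsSpectral.tentTwirl_exp_neg (h : IsSpectral A U e) :
    tentTwirl A (NormedSpace.exp (-A)) = NormedSpace.exp (-A) := by
  rw [h.tentTwirl_eq, h.exp_neg, schurMul_conjDiag h.star_mul]
  simp only [tentSymbol_diag, one_mul]

theorem IsSpectral.trace_tentTwirl (h : IsSpectral A U e) (Y : Matrix n n ℂ) :
    (tentTwirl A Y).trace = Y.trace := by
  have h1 : tentTwirl A 1 = 1 := by
    rw [h.tentTwirl_eq, ← conjDiag_one h.mul_star, schurMul_conjDiag h.star_mul]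
    simp only [tentSymbol_diag, one_mul]
  have h2 := h.trace_tentTwirl_mul Y 1
  rwa [h1, Matrix.mul_one, Matrix.mul_one] at h2

/-- The derivative of the exponential along a curve of Hermitian matrices. -/
theorem hasDerivAt_exp_neg {B : ℝ → Matrix n n ℂ} {B' : Matrix n n ℂ} {x : ℝ}
    (hB : HasDerivAt B B' x) (hBh : ∀ y, (B y).IsHermitian) :
    HasDerivAt (fun y => NormedSpace.exp (-B y))
      ((-(1 / 2) : ℂ) • anticomm (tentTwirl (B x) B') (NormedSpace.exp (-B x))) x := by
  obtain ⟨U, e, h⟩ := exists_isSpectral (hBh x)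
  have hcfc : (fun y => NormedSpace.exp (-B y)) = fun y => cfc (fun t => Real.exp (-t)) (B y) := by
    ext1 y
    obtain ⟨W, g, hW⟩ := exists_isSpectral (hBh y)
    rw [hW.exp_neg, hW.cfc_eq]
  rw [hcfc, ← h.dividedDiff_exp_neg]
  exact hasDerivAt_cfc isOpen_univ (by fun_prop) hB (Set.subset_univ _) hBh h

/-- The derivative of the normalized exponential along a curve of Hermitian matrices. -/
theorem hasDerivAt_gibbs [Nonempty n] {B : ℝ → Matrix n n ℂ} {B' : Matrix n n ℂ} {x : ℝ}
    (hB : HasDerivAt B B' x) (hBh : ∀ y, (B y).IsHermitian) {S : Matrix n n ℂ}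
    (hS : S = (NormedSpace.exp (-B x)).trace⁻¹ • NormedSpace.exp (-B x))
    (hpos : (NormedSpace.exp (-B x)).trace ≠ 0) :
    HasDerivAt (fun y => (NormedSpace.exp (-B y)).trace⁻¹ • NormedSpace.exp (-B y))
      ((-(1 / 2) : ℂ) • anticomm (tentTwirl (B x) B') S + expect B' S • S) x := by
  obtain ⟨U, e, h⟩ := exists_isSpectral (hBh x)
  have hE := hasDerivAt_exp_neg hB hBh
  have htr := hasDerivAt_linearMap_comp hE (Matrix.traceLinearMap n ℂ ℂ)
  simp only [Matrix.traceLinearMap_apply] at htr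
  -- Under the trace the twirl moves onto `e^{-B}`, which commutes with `B` and is fixed.
  have hval : ((-(1 / 2) : ℂ) • anticomm (tentTwirl (B x) B') (NormedSpace.exp (-B x))).trace =
      -(B' * NormedSpace.exp (-B x)).trace := by
    rw [Matrix.trace_smul, anticomm, Matrix.trace_add,
      Matrix.trace_mul_comm (NormedSpace.exp (-B x)), h.trace_tentTwirl_mul, h.tentTwirl_exp_neg,
      smul_eq_mul]
    ring
  rw [hval] at htr
  have := (htr.fun_inv hpos).smul hE
  convert! this using 1
  rw [hS, expect, anticomm, anticomm]
  simp only [Matrix.mul_smul, Matrix.smul_mul, Matrix.trace_smul, smul_add, smul_smul, smul_eq_mul]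
  congr 1
  · congr 2 <;> ring
  · congr 1
    field_simp

theorem posDef_exp_neg (hA : A.IsHermitian) : (NormedSpace.exp (-A)).PosDef := by
  obtain ⟨U, e, h⟩ := exists_isSpectral hA
  rw [h.exp_neg]
  exact posDef_conjDiag h.mul_star fun i => by exact_mod_cast Real.exp_pos _

theorem spectrum_subset_Ioi (hA : A.PosDef) : spectrum ℝ A ⊆ Set.Ioi 0 := by
  rw [hA.isHermitian.spectrum_real_eq_range_eigenvalues]
  rintro _ ⟨i, rfl⟩
  exact hA.eigenvalues_pos i

variable {q : ℝ}

theorem IsSpectral.dividedDiff_rpow (h : IsSpectral A U e) (hA : A.PosDef)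
    (hq : q ∈ Set.Ioo (0 : ℝ) 1 ∪ Set.Ioc (1 : ℝ) 2) (X : Matrix n n ℂ) :
    schurMul U (dividedDiff (fun x => x ^ (1 - q)) e)ᵀ X =
      (1 - q : ℂ) • (rpow A (-q / 2) * modularTwirl q A X * rpow A (-q / 2)) := by
  have hq1 : q ≠ 1 := by
    rintro rfl
    simp at hq
  rw [h.modularTwirl_eq hq, h.rpow_eq, conjDiag_mul_schurMul h.star_mul,
    schurMul_mul_conjDiag h.star_mul, ← smul_schurMul]
  congr 1
  ext i j
  simp only [dividedDiff, modularSymbol, Matrix.of_apply, Matrix.smul_apply,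
    Matrix.transpose_apply, dslope_rpow (h.pos hA j) (h.pos hA i) hq1, smul_eq_mul]
  rw [← neg_sub (Real.log (e i) / 2), sinhKernel_neg]
  push_cast
  ring

/-- By cyclicity the powers of `A` collapse to `A^{1-q}`, which the twirl fixes, so the twirl drops
out. -/
theorem IsSpectral.trace_rpow_mul_modularTwirl_mul (h : IsSpectral A U e) (hA : A.PosDef)
    (hq : q ∈ Set.Ioo (0 : ℝ) 1 ∪ Set.Ioc (1 : ℝ) 2) (X : Matrix n n ℂ) :
    (rpow A (-q / 2) * modularTwirl q A X * rpow A (-q / 2) * A).trace =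
      (X * rpow A (1 - q)).trace := by
  have hpow : rpow A (-q / 2) * A * rpow A (-q / 2) = rpow A (1 - q) := by
    conv_lhs => enter [1, 2]; rw [h.eq_conjDiag]
    rw [h.rpow_eq, h.rpow_eq, conjDiag_mul h.star_mul, conjDiag_mul h.star_mul]
    congr 1
    ext i
    have hpos := h.pos hA i
    rw [← Complex.ofReal_mul, ← Complex.ofReal_mul, ← Real.rpow_add_one hpos.ne',
      ← Real.rpow_add hpos]
    ring_nf
  rw [Matrix.mul_assoc, Matrix.mul_assoc, Matrix.trace_mul_comm, Matrix.mul_assoc, hpow,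
    h.modularTwirl_eq hq, ← modularSymbol_transpose, ← trace_mul_schurMul, h.rpow_eq,
    schurMul_conjDiag h.star_mul]
  simp only [modularSymbol_diag, one_mul]

/-- The derivative of the Petz--Tsallis relative entropy along a curve of positive definite
matrices. -/
theorem hasDerivAt_petzTsallis {ρ B' : Matrix n n ℂ} {B : ℝ → Matrix n n ℂ} {x : ℝ}
    (hB : HasDerivAt B B' x) (hBp : ∀ y, (B y).PosDef)
    (hq : q ∈ Set.Ioo (0 : ℝ) 1 ∪ Set.Ioc (1 : ℝ) 2) :
    HasDerivAt (fun y => petzTsallis q ρ (B y))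
      (-(rpow (B x) (-q / 2) * modularTwirl q (B x) (rpow ρ q) * rpow (B x) (-q / 2) * B').trace)
      x := by
  obtain ⟨U, e, h⟩ := exists_isSpectral (hBp x).isHermitian
  have hq1 : (q : ℂ) - 1 ≠ 0 := by
    intro h0
    have : q = 1 := by exact_mod_cast sub_eq_zero.1 h0
    subst this
    simp at hq
  -- The power is not differentiable at 0; positive definiteness keeps the spectrum in the open
  -- half-line.
  have hd := hasDerivAt_cfc (f := fun t => t ^ (1 - q)) isOpen_Ioi
    (fun t ht => (Real.differentiableAt_rpow_const_of_ne _
      (ne_of_gt ht)).differentiableWithinAt) hB (spectrum_subset_Ioi (hBp x))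
    (fun y => (hBp y).isHermitian) h
  have ht := ((hasDerivAt_trace_mul hd (rpow ρ q)).sub_const 1).div_const ((q : ℂ) - 1)
  convert! ht using 1
  rw [trace_mul_schurMul, h.dividedDiff_rpow (hBp x) hq, Matrix.smul_mul, Matrix.trace_smul,
    smul_eq_mul]
  field_simp
  ring

end

/-- The densities degenerate as `r → -1`, but at each fixed gap the kernel is continuous in `r`
there, and the twirl is a finite sum of such kernel values. -/
theorem tendsto_modularTwirl {n : Type*} [Fintype n] [DecidableEq n] {A : Matrix n n ℂ}
    (hA : A.IsHermitian) (X : Matrix n n ℂ) :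
    Filter.Tendsto (fun s : ℝ => modularTwirl s A X) (nhdsWithin 2 (Set.Iio 2))
      (nhds (modularTwirl 2 A X)) := by
  obtain ⟨U, e, h⟩ := exists_isSpectral hA
  have hev : ∀ᶠ s : ℝ in nhdsWithin 2 (Set.Iio 2), s ∈ Set.Ioo (1 : ℝ) 2 :=
    Ioo_mem_nhdsLT (by norm_num)
  rw [h.modularTwirl_eq (Or.inr ⟨by norm_num, le_rfl⟩)]
  refine Filter.Tendsto.congr' (hev.mono fun s hs =>
    (h.modularTwirl_eq (Or.inr ⟨hs.1, hs.2.le⟩) X).symm) ?_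
  refine Filter.Tendsto.mono_left ?_ nhdsWithin_le_nhds
  refine tendsto_pi_nhds.2 fun a => tendsto_pi_nhds.2 fun b => ?_
  simp only [schurMul_apply]
  refine tendsto_finsetSum _ fun j _ => tendsto_finsetSum _ fun i _ => Filter.Tendsto.mul_const _ ?_
  simp only [modularSymbol, Matrix.of_apply]
  refine (Complex.continuous_ofReal.tendsto _).comp ?_
  generalize Real.log (e i) / 2 - Real.log (e j) / 2 = ω
  by_cases hω : ω = 0
  · simp only [hω, sinhKernel_zero]
    exact tendsto_const_nhds
  · simp only [sinhKernel, if_neg hω]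
    have hne : (1 - 2 : ℝ) * Real.sinh ω ≠ 0 := mul_ne_zero (by norm_num) (by simpa using hω)
    exact ContinuousAt.div (by fun_prop) (by fun_prop) hne

/-! ### Partial trace, visible states and the map `Σ` -/

section Machine

variable {V H : Type*} [Fintype V] [DecidableEq V] [Fintype H] [DecidableEq H] {J : ℕ}

theorem traceHidden_eq_sum (A : Matrix (V × H) (V × H) ℂ) :
    traceHidden A = ∑ h, A.submatrix (fun a => (a, h)) fun a => (a, h) := by
  ext a b
  simp [traceHidden, Matrix.sum_apply]

/-- The partial trace over the hidden system, as a linear map. -/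
def traceHiddenLinear : Matrix (V × H) (V × H) ℂ →ₗ[ℂ] Matrix V V ℂ where
  toFun := traceHidden
  map_add' A B := by
    ext a b
    simp [traceHidden, Finset.sum_add_distrib]
  map_smul' c A := by
    ext a b
    simp [traceHidden, Finset.mul_sum]

theorem posDef_traceHidden [Nonempty H] {A : Matrix (V × H) (V × H) ℂ} (hA : A.PosDef) :
    (traceHidden A).PosDef := by
  rw [traceHidden_eq_sum]
  refine Matrix.posDef_sum Finset.univ_nonempty fun h _ => hA.submatrix fun a b hab => ?_
  simpa using hab

theorem trace_mul_traceHidden (R : Matrix V V ℂ) (M : Matrix (V × H) (V × H) ℂ) :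
    (R * traceHidden M).trace = ((R ⊗ₖ (1 : Matrix H H ℂ)) * M).trace := by
  simp only [Matrix.trace, Matrix.diag_apply, Matrix.mul_apply, traceHidden, Matrix.of_apply,
    Fintype.sum_prod_type, Matrix.kroneckerMap_apply, Matrix.one_apply, mul_ite, mul_one, mul_zero,
    ite_mul, zero_mul, Finset.sum_ite_eq, Finset.mem_univ, if_true, Finset.mul_sum]
  exact Finset.sum_congr rfl fun a _ => Finset.sum_comm

variable {G : Fin J → Matrix (V × H) (V × H) ℂ}

theorem isHermitian_hamiltonian (hG : ∀ j, (G j).IsHermitian) (θ : Fin J → ℝ) :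
    (hamiltonian G θ).IsHermitian := by
  rw [Matrix.IsHermitian, hamiltonian, Matrix.conjTranspose_sum]
  refine Finset.sum_congr rfl fun j _ => ?_
  rw [Matrix.conjTranspose_smul, (hG j).eq]
  simp

theorem hasDerivAt_hamiltonian (θ : Fin J → ℝ) (j : Fin J) :
    HasDerivAt (fun x => hamiltonian G (Function.update θ j x)) (G j) (θ j) := by
  have h : (fun x => hamiltonian G (Function.update θ j x)) =
      fun x : ℝ => hamiltonian G θ + (x - θ j) • G j := by
    ext1 x
    rw [hamiltonian, hamiltonian, ← Finset.add_sum_erase _ _ (Finset.mem_univ j),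
      ← Finset.add_sum_erase (a := j) (f := fun j => (θ j : ℂ) • G j) _ (Finset.mem_univ j),
      Finset.sum_congr (g := fun j => (θ j : ℂ) • G j) rfl fun k hk => by
        rw [Function.update_of_ne (Finset.ne_of_mem_erase hk)]]
    rw [Function.update_self, ← Complex.coe_smul, Complex.ofReal_sub]
    module
  rw [h]
  simpa using ((((hasDerivAt_id (θ j)).sub_const (θ j)).smul_const (G j)).const_add
    (hamiltonian G θ))

section Nonempty

variable [Nonempty V] [Nonempty H]

theorem trace_exp_neg_pos (hG : ∀ j, (G j).IsHermitian) (θ : Fin J → ℝ) :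
    0 < (NormedSpace.exp (-hamiltonian G θ)).trace :=
  (posDef_exp_neg (isHermitian_hamiltonian hG θ)).trace_pos

theorem posDef_thermalState (hG : ∀ j, (G j).IsHermitian) (θ : Fin J → ℝ) :
    (thermalState G θ).PosDef :=
  (posDef_exp_neg (isHermitian_hamiltonian hG θ)).smul (inv_pos.2 (trace_exp_neg_pos hG θ))

theorem posDef_visibleState (hG : ∀ j, (G j).IsHermitian) (θ : Fin J → ℝ) :
    (visibleState G θ).PosDef :=
  posDef_traceHidden (posDef_thermalState hG θ)

theorem trace_visibleState (hG : ∀ j, (G j).IsHermitian) (θ : Fin J → ℝ) :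
    (visibleState G θ).trace = 1 := by
  have h := trace_mul_traceHidden 1 (thermalState G θ)
  rw [Matrix.one_mul, Matrix.one_kronecker_one, Matrix.one_mul] at h
  rw [visibleState, h, thermalState, Matrix.trace_smul, smul_eq_mul,
    inv_mul_cancel₀ (trace_exp_neg_pos hG θ).ne']

theorem hasDerivAt_visibleState (hG : ∀ j, (G j).IsHermitian) (θ : Fin J → ℝ) (j : Fin J) :
    HasDerivAt (fun x => visibleState G (Function.update θ j x))
      (traceHidden ((-(1 / 2) : ℂ) •
        anticomm (tentTwirl (hamiltonian G θ) (G j)) (thermalState G θ) +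
          expect (G j) (thermalState G θ) • thermalState G θ)) (θ j) := by
  have hd := hasDerivAt_gibbs (S := thermalState G θ) (hasDerivAt_hamiltonian θ j)
    (fun y => isHermitian_hamiltonian hG _) (by rw [Function.update_eq_self]; rfl)
    (trace_exp_neg_pos hG _).ne'
  rw [Function.update_eq_self] at hd
  exact hasDerivAt_linearMap_comp hd traceHiddenLinear

variable {q : ℝ}

/-- Serves twice: at `X = ρ^q` it identifies the factor `Q_q` in the gradient, and for general `X`
it computes the trace of `Σ(X)`. -/
theorem trace_xiMap_modularTwirl (hG : ∀ j, (G j).IsHermitian) (θ : Fin J → ℝ)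
    (hq : q ∈ Set.Ioo (0 : ℝ) 1 ∪ Set.Ioc (1 : ℝ) 2) (X : Matrix V V ℂ) :
    (xiMap G θ q (modularTwirl q (visibleState G θ) X)).trace =
      (X * rpow (visibleState G θ) (1 - q)).trace := by
  have hp := posDef_visibleState hG θ
  obtain ⟨U, e, h⟩ := exists_isSpectral hp.isHermitian
  rw [← h.trace_rpow_mul_modularTwirl_mul hp hq, xiMap, anticomm, Matrix.trace_smul,
    Matrix.trace_add, Matrix.trace_mul_comm (thermalState G θ), ← trace_mul_traceHidden,
    ← visibleState, smul_eq_mul]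
  ring

theorem hasDerivAt_petzTsallis_visibleState (hG : ∀ j, (G j).IsHermitian) (ρ : Matrix V V ℂ)
    (hq : q ∈ Set.Ioo (0 : ℝ) 1 ∪ Set.Ioc (1 : ℝ) 2) (θ : Fin J → ℝ) (j : Fin J) :
    HasDerivAt (fun x => petzTsallis q ρ (visibleState G (Function.update θ j x)))
      (expect (G j) (sigmaMap G θ q (rpow ρ q)) -
        petzQ q ρ (visibleState G θ) * expect (G j) (thermalState G θ)) (θ j) := by
  have hd := hasDerivAt_petzTsallis (ρ := ρ) (hasDerivAt_visibleState hG θ j)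
    (fun y => posDef_visibleState hG _) hq
  rw [Function.update_eq_self] at hd
  convert! hd using 1
  obtain ⟨U, e, h⟩ := exists_isSpectral (isHermitian_hamiltonian hG θ)
  have hxi := trace_xiMap_modularTwirl hG θ hq (rpow ρ q)
  -- After the tent twirl moves to `G j` and the partial trace becomes `⊗ 1`, both sides agree by
  -- cyclicity of the trace.
  rw [petzQ, ← hxi, expect, sigmaMap, ← h.trace_tentTwirl_mul, trace_mul_traceHidden]
  simp only [xiMap, anticomm]
  generalize (rpow (visibleState G θ) (-q / 2) *
    modularTwirl q (visibleState G θ) (rpow ρ q) * rpow (visibleState G θ) (-q / 2)) ⊗ₖ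
      (1 : Matrix H H ℂ) = R
  generalize tentTwirl (hamiltonian G θ) (G j) = P
  generalize expect (G j) (thermalState G θ) = c
  generalize thermalState G θ = S
  simp only [Matrix.mul_add, Matrix.mul_smul, Matrix.trace_add, Matrix.trace_smul, smul_eq_mul]
  have e1 : (P * (S * R)).trace = (R * (P * S)).trace := by
    rw [← Matrix.mul_assoc, Matrix.trace_mul_comm]
  have e2 : (P * (R * S)).trace = (R * (S * P)).trace := by
    rw [Matrix.trace_mul_comm, Matrix.mul_assoc]
  have e3 : (S * R).trace = (R * S).trace := Matrix.trace_mul_comm _ _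
  rw [e1, e2, e3]
  ring

theorem isLinearMap_sigmaMap (hG : ∀ j, (G j).IsHermitian) (θ : Fin J → ℝ)
    (hq : q ∈ Set.Ioo (0 : ℝ) 1 ∪ Set.Ioc (1 : ℝ) 2) : IsLinearMap ℂ (sigmaMap G θ q) := by
  obtain ⟨U, e, h⟩ := exists_isSpectral (isHermitian_hamiltonian hG θ)
  obtain ⟨W, g, hW⟩ := exists_isSpectral (posDef_visibleState hG θ).isHermitian
  constructor
  · intro X Y
    simp only [sigmaMap, h.tentTwirl_eq, hW.modularTwirl_eq hq, xiMap, anticomm, schurMul_add,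
      Matrix.mul_add, Matrix.add_mul, Matrix.add_kronecker, smul_add]
    abel
  · intro c X
    simp only [sigmaMap, h.tentTwirl_eq, hW.modularTwirl_eq hq, xiMap, anticomm, schurMul_smul,
      Matrix.mul_smul, Matrix.smul_mul, Matrix.smul_kronecker, ← smul_add, smul_comm _ c]

theorem isHermitian_sigmaMap (hG : ∀ j, (G j).IsHermitian) (θ : Fin J → ℝ)
    (hq : q ∈ Set.Ioo (0 : ℝ) 1 ∪ Set.Ioc (1 : ℝ) 2) {X : Matrix V V ℂ} (hX : X.IsHermitian) :
    (sigmaMap G θ q X).IsHermitian := by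
  obtain ⟨U, e, h⟩ := exists_isSpectral (isHermitian_hamiltonian hG θ)
  obtain ⟨W, g, hW⟩ := exists_isSpectral (posDef_visibleState hG θ).isHermitian
  have hr : (rpow (visibleState G θ) (-q / 2))ᴴ = rpow (visibleState G θ) (-q / 2) :=
    (cfc_predicate (fun x : ℝ => x ^ (-q / 2)) (visibleState G θ)).star_eq
  have hS := (posDef_thermalState hG θ).isHermitian.eq
  rw [Matrix.IsHermitian, sigmaMap, h.tentTwirl_eq, conjTranspose_schurMul,
    tentSymbol_conjTranspose, hW.modularTwirl_eq hq]
  congr 1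
  simp only [xiMap, anticomm, Matrix.conjTranspose_smul, Matrix.conjTranspose_add,
    Matrix.conjTranspose_mul, Matrix.conjTranspose_kronecker, conjTranspose_schurMul,
    modularSymbol_conjTranspose, hr, hS, hX.eq, Matrix.conjTranspose_one, Matrix.mul_assoc]
  rw [add_comm]
  simp

theorem exists_trace_sigmaMap_ne (hG : ∀ j, (G j).IsHermitian) (θ : Fin J → ℝ)
    (hq : q ∈ Set.Ioo (0 : ℝ) 1 ∪ Set.Ioc (1 : ℝ) 2) (hV : 2 ≤ Fintype.card V) :
    ∃ X : Matrix V V ℂ, (sigmaMap G θ q X).trace ≠ X.trace := by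
  by_contra! hall
  have hp := posDef_visibleState hG θ
  obtain ⟨U, e, h⟩ := exists_isSpectral (isHermitian_hamiltonian hG θ)
  obtain ⟨W, g, hW⟩ := exists_isSpectral hp.isHermitian
  have hq1 : 1 - q ≠ 0 := by
    intro h0
    obtain rfl : q = 1 := by linarith
    simp at hq
  -- Testing on the `i`-th eigenprojection of the visible state gives `g i ^ (1 - q) = 1`, and the
  -- exponent is nonzero.
  have hg : ∀ i, g i = 1 := fun i => by
    have hi := hall (conjDiag W (Pi.single i 1))
    rw [sigmaMap, h.trace_tentTwirl, trace_xiMap_modularTwirl hG θ hq, hW.rpow_eq,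
      conjDiag_mul hW.star_mul, trace_conjDiag hW.star_mul, trace_conjDiag hW.star_mul] at hi
    simp only [Pi.single_apply, ite_mul, one_mul, zero_mul, Finset.sum_ite_eq', Finset.mem_univ,
      if_true] at hi
    have hi' : g i ^ (1 - q) = 1 := by exact_mod_cast hi
    exact (Real.rpow_left_inj (hW.pos hp i).le zero_le_one hq1).1 (by rw [hi', Real.one_rpow])
  have htr := trace_visibleState hG θ
  rw [hW.eq_conjDiag, trace_conjDiag hW.star_mul] at htr
  simp only [hg, Complex.ofReal_one, Finset.sum_const, Finset.card_univ, nsmul_eq_mul,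
    mul_one] at htr
  have : Fintype.card V = 1 := by exact_mod_cast htr
  omega

end Nonempty

end Machine

end QBM

end

theorem mainTheorem5 {V H : Type*} [Fintype V] [DecidableEq V] [Nonempty V]
    [Fintype H] [DecidableEq H] [Nonempty H] (J : ℕ)
    (G : Fin J → Matrix (V × H) (V × H) ℂ) (hG : ∀ j, (G j).IsHermitian)
    (ρ : Matrix V V ℂ) (hρ : ρ.PosSemidef) (hρ_tr : ρ.trace = 1)
    (q : ℝ) (hq : q ∈ Set.Ioo (0 : ℝ) 1 ∪ Set.Ioc (1 : ℝ) 2) (θ : Fin J → ℝ) :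
    -- the partial derivatives exist and are given by the gradient formula
    (∀ j, HasDerivAt
      (fun x : ℝ => QBM.petzTsallis q ρ (QBM.visibleState G (Function.update θ j x)))
      (QBM.expect (G j) (QBM.sigmaMap G θ q (QBM.rpow ρ q))
        - QBM.petzQ q ρ (QBM.visibleState G θ) * QBM.expect (G j) (QBM.thermalState G θ))
      (θ j)) ∧
    -- `β_{1-q}` is a probability density (for `q = 2` it degenerates to a point mass at `0`)
    (q ≠ 2 → (∀ t, 0 ≤ QBM.betaDensity (1 - q) t) ∧
      ∫ t, QBM.betaDensity (1 - q) t = 1) ∧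
    -- the twirl at order `2` is the limit of the twirls of order `s`, as `s` increases to `2`
    (∀ X : Matrix V V ℂ, Filter.Tendsto
      (fun s : ℝ => QBM.modularTwirl s (QBM.visibleState G θ) X) (nhdsWithin 2 (Set.Iio 2))
      (nhds (QBM.modularTwirl 2 (QBM.visibleState G θ) X))) ∧
    -- the map is linear and Hermiticity preserving
    IsLinearMap ℂ (QBM.sigmaMap G θ q) ∧
    (∀ X : Matrix V V ℂ, X.IsHermitian → (QBM.sigmaMap G θ q X).IsHermitian) ∧
    -- it is not trace preserving as soon as the visible system is nontrivial
    (2 ≤ Fintype.card V → ∃ X : Matrix V V ℂ, (QBM.sigmaMap G θ q X).trace ≠ X.trace) := by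
  have hσ := QBM.posDef_visibleState hG θ
  refine ⟨QBM.hasDerivAt_petzTsallis_visibleState hG ρ hq θ, fun hq2 => ?_,
    QBM.tendsto_modularTwirl hσ.isHermitian, QBM.isLinearMap_sigmaMap hG θ hq,
    fun X hX => QBM.isHermitian_sigmaMap hG θ hq hX, QBM.exists_trace_sigmaMap_ne hG θ hq⟩
  have hr : 1 - q ≠ 0 ∧ |1 - q| < 1 := by
    rw [abs_lt]
    rcases hq with ⟨h1, h2⟩ | ⟨h1, h2⟩
    · exact ⟨by linarith, by linarith, by linarith⟩
    · have := lt_of_le_of_ne h2 hq2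
      exact ⟨by linarith, by linarith, by linarith⟩
  exact ⟨QBM.betaDensity_nonneg hr.2, QBM.integral_betaDensity hr.1 hr.2⟩
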